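/- Let $d,N_a\ge 1$. Let $S\in\mathbb R^{d\times d}$ be the shift matrix (ones on the upper diagonal, zeros elsewhere), $B=(0,\dots,0,1)^T\in\mathbb R^{d}$, $C=(1,0,\dots,0)\in\mathbb R^{1\times d}$, and let $\phi:\mathbb R^d\to\mathbb R$ be globally Lipschitz. Suppose there is a nonempty compact set $W\subset\mathbb R^d$, (forward) invariant for $\dot w=Sw+B\phi(w)$, such that $\dot w=Sw+B\phi(w)+u$ is input-to-state stable relative to $W$: there are a class-$\mathcal{KL}$ function $\beta$ and a class-$\mathcal K$ function $\gamma$ such that, with $\|w\|_W=\min_{x\in W}\|w-x\|$, every solution with a measurable locally bounded input $u:[0,\infty)\to\mathbb R^d$ satisfies $\|w(t)\|_W\le\max\{\beta(\|w(0)\|_W,t),\gamma(\sup_{s\in[0,t)}\|u(s)\|)\}$ for all $t\ge 0$. Let $\mathcal T_1,\dots,\mathcal T_{N_t}$ be finitely many weighted directed graphs on $\{1,\dots,N_a\}$ without self-loops, the $i$-th with adjacency matrix $(a^i_{kj})$, $a^i_{kj}\ge 0$, where there is an edge carrying information from $j$ to $k$ if and only if $a^i_{kj}>0$. A graph is called connected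 if from some node every other node can be reached along the flow of information, and disconnected otherwise. Let $\mu>0$ be such that every nonzero eigenvalue of every Laplacian $L_i$ (with entries $-a^i_{kj}$ for $k\neq j$ and $\sum_m a^i_{km}$ for $k=j$) has real part at least $\mu$. Let $a>0$, and let $P$ be a symmetric positive definite solution of $SP+PS^T-2\mu PC^TCP+aI=0$. For $g>0$ put $D_g=\mathrm{diag}(g,g^2,\dots,g^d)$. Let $T_0>0$. A switching sequence consists of topologies $\mathcal T_{\sigma(1)},\mathcal T_{\sigma(2)},\dots$ active on consecutive time intervals of lengths $\Delta T_1,\Delta T_2,\ldots\ge 0$ starting at time $0$, where $\mathcal T_{\sigma(i)}$ is connected for $i$ odd and disconnected for $i$ even (for intervals of length zero the topology is irrelevant). For $\tau>0$ and an integer $n_0\ge 1$ the sequence is called admissible if the intervals with disconnected topologies have length at most $T_0$ and if, for all integers $n\ge 0$ and all odd $i_0\geq 1$, $$\sum_{m=0}^{n}\Delta T_{i_0+2m}\ \ge\ \tau\,(n-n_0).$$ Consider the closed-loop network, in which, on each interval whose active topology is $\mathcal T_i$, $$\dot w_k=Sw_k+B\phi(w_k)+D_gPC^T\sum_{j=1}^{N_a}a^i_{kj}(Cw_j-Cw_k),\qquad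 k=1,\dots,N_a .$$ Then there exist $\tau^\star>0$ and $g^\star>0$ such that for all $\tau\ge\tau^\star$, all $g\ge g^\star$ and all $n_0\ge 1$ the following holds. For every admissible switching sequence and every initial condition the closed-loop network has a solution on $[0,\infty)$; the set $$\mathbf W=\{(w_1,\dots,w_{N_a}) : w_1=w_2=\cdots=w_{N_a}\in W\}$$ is compact and forward invariant; and it is globally asymptotically stable, uniformly over all admissible switching sequences: there is a class-$\mathcal{KL}$ function $\hat\beta$ such that every closed-loop solution $\mathbf w$ under every admissible switching sequence satisfies $\mathrm{dist}(\mathbf w(t),\mathbf W)\le\hat\beta(\mathrm{dist}(\mathbf w(0),\mathbf W),t)$ for all $t\ge 0$. -/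

import Mathlib

open scoped Matrix

noncomputable section

namespace Consensus

/-! ### Comparison functions, invariance and stability of a family of motions -/

/-- Class `K`: continuous and strictly increasing on `[0, ∞)`, vanishing at `0`. -/
structure IsClassK (γ : ℝ → ℝ) : Prop where
  continuousOn : ContinuousOn γ (Set.Ici 0)
  strictMonoOn : StrictMonoOn γ (Set.Ici 0)
  map_zero : γ 0 = 0

/-- Class `KL`: class `K` in the first argument; nonincreasing and tending to `0` in the second. -/
structure IsClassKL (β : ℝ → ℝ → ℝ) : Prop where
  isClassK : ∀ t, 0 ≤ t → IsClassK (fun r => β r t)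
  antitoneOn : ∀ r, 0 ≤ r → AntitoneOn (β r) (Set.Ici 0)
  tendsto_zero : ∀ r, 0 ≤ r → Filter.Tendsto (β r) Filter.atTop (nhds 0)

/-- A set is (forward) invariant for a family of motions if motions starting in it stay in it. -/
def IsInvariant {X : Type*} (traj : Set (ℝ → X)) (A : Set X) : Prop :=
  ∀ x ∈ traj, x 0 ∈ A → ∀ t, 0 ≤ t → x t ∈ A

/-- Global asymptotic stability of a set `A` for a family of motions on `[0, ∞)`,
with a class-`KL` bound on the distance that is common to all the motions of the family. -/
def IsGloballyAsymptoticallyStable {X : Type*} [PseudoMetricSpace X]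
    (traj : Set (ℝ → X)) (A : Set X) : Prop :=
  ∃ β : ℝ → ℝ → ℝ, IsClassKL β ∧
    ∀ x ∈ traj, ∀ t, 0 ≤ t → Metric.infDist (x t) A ≤ β (Metric.infDist (x 0) A) t

/-! ### The agents -/

/-- The state space `ℝ^d` of one agent, with the Euclidean norm. -/
abbrev AgentState (d : ℕ) : Type := EuclideanSpace ℝ (Fin d)

/-- The shift matrix: ones on the upper diagonal, zeros elsewhere. -/
def S (d : ℕ) : Matrix (Fin d) (Fin d) ℝ :=
  Matrix.of fun i j => if (i : ℕ) + 1 = (j : ℕ) then 1 else 0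

/-- The column `(0, …, 0, 1)ᵀ`. -/
def B (d : ℕ) : Matrix (Fin d) (Fin 1) ℝ :=
  Matrix.of fun i _ => if (i : ℕ) + 1 = d then 1 else 0

/-- The row `(1, 0, …, 0)`. -/
def C (d : ℕ) : Matrix (Fin 1) (Fin d) ℝ :=
  Matrix.of fun _ j => if (j : ℕ) = 0 then 1 else 0

/-- The drift `S w + B φ(w)` of an agent. -/
def drift {d : ℕ} (φ : AgentState d → ℝ) (w : AgentState d) : AgentState d :=
  WithLp.toLp 2 (S d *ᵥ w.ofLp + B d *ᵥ (fun _ => φ w))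

/-- An admissible input: measurable, and bounded on bounded time intervals. -/
structure IsInput {d : ℕ} (u : ℝ → AgentState d) : Prop where
  measurable : Measurable u
  locallyBounded : ∀ t, BddAbove ((fun s => ‖u s‖) '' Set.Ico 0 t)

/-- `w` is a (Carathéodory) solution on `[0, ∞)` of `ẇ = S w + B φ(w) + u`. -/
structure IsAgentSolution {d : ℕ} (φ : AgentState d → ℝ) (u w : ℝ → AgentState d) : Prop where
  continuousOn : ContinuousOn w (Set.Ici 0)
  integral_eq : ∀ t, 0 ≤ t → w t = w 0 + ∫ s in (0 : ℝ)..t, (drift φ (w s) + u s)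

/-- `ẇ = S w + B φ(w) + u` is input-to-state stable with respect to `u`, relative to `W`. -/
def IsISS {d : ℕ} (φ : AgentState d → ℝ) (W : Set (AgentState d)) : Prop :=
  ∃ (β : ℝ → ℝ → ℝ) (γ : ℝ → ℝ), IsClassKL β ∧ IsClassK γ ∧
    ∀ u w : ℝ → AgentState d, IsInput u → IsAgentSolution φ u w → ∀ t, 0 ≤ t →
      Metric.infDist (w t) W ≤
        max (β (Metric.infDist (w 0) W) t) (γ (sSup ((fun s => ‖u s‖) '' Set.Ico 0 t)))

/-- `W` is a nonempty compact set, invariant for the agent with zero input, relative to which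
the agent is input-to-state stable. -/
structure IsRobustAttractor {d : ℕ} (φ : AgentState d → ℝ) (W : Set (AgentState d)) : Prop where
  nonempty : W.Nonempty
  isCompact : IsCompact W
  isInvariant : IsInvariant {w | IsAgentSolution φ (fun _ => 0) w} W
  isISS : IsISS φ W

/-! ### The communication topologies -/

/-- A weighted directed communication graph on `N` nodes without self-loops. The weight `adj k j`
is that of the flow of information from node `j` to node `k`, and the corresponding edge is
present if and only if the weight is positive. -/
structure CommTopology (N : ℕ) where
  adj : Matrix (Fin N) (Fin N) ℝ
  adj_nonneg : ∀ k j, 0 ≤ adj k j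
  adj_self : ∀ k, adj k k = 0

/-- The Laplacian matrix. -/
def CommTopology.laplacian {N : ℕ} (G : CommTopology N) : Matrix (Fin N) (Fin N) ℝ :=
  Matrix.of fun k j => if k = j then ∑ m, G.adj k m else -G.adj k j

/-- Some node reaches every node along the flow of information. -/
def CommTopology.Connected {N : ℕ} (G : CommTopology N) : Prop :=
  ∃ v, ∀ k, Relation.ReflTransGen (fun j k => 0 < G.adj k j) v k

/-- The complex eigenvalues of the Laplacian that are not zero have real part at least `μ`. -/
def CommTopology.SpectralBound {N : ℕ} (G : CommTopology N) (μ : ℝ) : Prop :=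
  ∀ z ∈ spectrum ℂ (G.laplacian.map (fun x : ℝ => (x : ℂ))), z ≠ 0 → μ ≤ z.re

/-- An ordered sequence of topologies, indexed from `0`, with the lengths of the time intervals
in which they are active. -/
structure SwitchingSequence (Nt : ℕ) where
  top : ℕ → Fin Nt
  len : ℕ → ℝ
  len_nonneg : ∀ i, 0 ≤ len i

/-- The time at which the interval with index `i` begins. -/
def SwitchingSequence.time {Nt : ℕ} (σ : SwitchingSequence Nt) (i : ℕ) : ℝ :=
  ∑ j ∈ Finset.range i, σ.len j

/-- Connected topologies (at even indices, as counting starts from `0`) alternate with disconnected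
ones (at odd indices), where the topology of an interval of zero length is irrelevant;
disconnected intervals last at most `T₀`; and the lengths of the connected intervals satisfy the
average dwell-time condition with constants `τ` and `n₀`. -/
structure SwitchingSequence.Admissible {N Nt : ℕ} (σ : SwitchingSequence Nt)
    (G : Fin Nt → CommTopology N) (T₀ τ : ℝ) (n₀ : ℕ) : Prop where
  alternate : ∀ i, 0 < σ.len i → ((G (σ.top i)).Connected ↔ Even i)
  disconnected_le : ∀ i, ¬ (G (σ.top i)).Connected → σ.len i ≤ T₀
  dwell : ∀ i₀ n : ℕ, Even i₀ →
    τ * ((n : ℝ) - (n₀ : ℝ)) ≤ ∑ m ∈ Finset.range (n + 1), σ.len (i₀ + 2 * m)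

/-! ### The closed loop -/

/-- `P` is a positive definite solution of `S P + P Sᵀ - 2 μ P Cᵀ C P + a I = 0`. -/
structure IsRiccatiSolution {d : ℕ} (P : Matrix (Fin d) (Fin d) ℝ) (μ a : ℝ) : Prop where
  posDef : P.PosDef
  equation : S d * P + P * (S d)ᵀ - (2 * μ) • (P * (C d)ᵀ * C d * P) + a • 1 = 0

/-- The gain `K = D_g P Cᵀ`, with `D_g = diag(g, g², …, g^d)`. -/
def gain {d : ℕ} (P : Matrix (Fin d) (Fin d) ℝ) (g : ℝ) : Matrix (Fin d) (Fin 1) ℝ :=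
  Matrix.diagonal (fun i : Fin d => g ^ ((i : ℕ) + 1)) * (P * (C d)ᵀ)

/-- The control `u_k = K ∑ⱼ a_kj (C w_j - C w_k)` of agent `k` under the topology `G`. -/
def control {d N : ℕ} (G : CommTopology N) (K : Matrix (Fin d) (Fin 1) ℝ)
    (w : Fin N → AgentState d) (k : Fin N) : AgentState d :=
  WithLp.toLp 2
    (K *ᵥ ∑ j, G.adj k j • (C d *ᵥ (w j).ofLp - C d *ᵥ (w k).ofLp))

/-- The closed-loop vector field of the network under the topology `G`. -/
def networkField {d N : ℕ} (φ : AgentState d → ℝ) (G : CommTopology N)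
    (K : Matrix (Fin d) (Fin 1) ℝ) (w : Fin N → AgentState d) : Fin N → AgentState d :=
  fun k => drift φ (w k) + control G K w k

/-- `w` is a motion of the switched closed-loop network: on each interval of the switching
sequence it solves the differential equation of the topology that is active there
(at the end points with one-sided derivatives). -/
def IsNetworkSolution {d N Nt : ℕ} (φ : AgentState d → ℝ) (G : Fin Nt → CommTopology N)
    (K : Matrix (Fin d) (Fin 1) ℝ) (σ : SwitchingSequence Nt)
    (w : ℝ → Fin N → AgentState d) : Prop :=
  ∀ i : ℕ, ∀ t ∈ Set.Icc (σ.time i) (σ.time (i + 1)),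
    HasDerivWithinAt w (networkField φ (G (σ.top i)) K (w t))
      (Set.Icc (σ.time i) (σ.time (i + 1))) t

/-- All the closed-loop motions under all the admissible switching sequences. -/
def networkMotions {d N Nt : ℕ} (φ : AgentState d → ℝ) (G : Fin Nt → CommTopology N)
    (K : Matrix (Fin d) (Fin 1) ℝ) (T₀ τ : ℝ) (n₀ : ℕ) : Set (ℝ → Fin N → AgentState d) :=
  {w | ∃ σ : SwitchingSequence Nt, σ.Admissible G T₀ τ n₀ ∧ IsNetworkSolution φ G K σ w}

/-- The synchronized set `{(w_1, …, w_N) : w_1 = ⋯ = w_N ∈ W}`. -/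
def syncSet {d : ℕ} (N : ℕ) (W : Set (AgentState d)) : Set (Fin N → AgentState d) :=
  {w | (∀ k, w k ∈ W) ∧ ∀ j k, w j = w k}

end Consensus

end

open scoped Matrix

noncomputable section

namespace Consensus

/-! ### Accretivity of operators with spectrum in a half-plane -/

/-! The closed loop is a cascade: the disagreements relative to a reference agent `o` decay
exponentially, and `o` is a single agent whose input is the coupling term, which is bounded by the
disagreements.

Disagreements. Dividing component `i` of `w k - w o` (counted from `0`) by `g ^ (i + 1)` turns the
linear part into `g` times a map that does not depend on `g`, while the nonlinearity remains bounded
by a multiple of the disagreement independent of `g` (`scaledDisagreement_networkField`,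
`norm_disagreementPerturbation_le`). For a connected topology the reduced Laplacian has its spectrum
in `re ≥ μ` (`CommTopology.Connected.le_re_of_mem_spectrum`). It is thus almost accretive in
suitable coordinates `R` (`exists_accretive_matrix`), and together with the Riccati equation this
makes `tr (R X P⁻¹ (R X)ᵀ)` a Lyapunov function (`exists_lyapunov_form`). For large `g` the decay
rate is `g κ` with an overshoot `M` independent of `g`; under any topology the growth rate is at
most `g r` (`exists_uniform_disagreement_bounds`).

Switching. The loss in one cycle is at most `M * exp (g r T₀)`, and the average dwell time provides
enough decay to compensate for it (`SwitchingSequence.Admissible.exponential_decay`). Both rates are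
proportional to `g`, so the dwell time needed can be chosen independently of `g`.

Cascade. Input-to-state stability of agent `o`, restarted at time `t / 2`, converts the exponential
decay of its input into a class-`KL` bound (`isGloballyAsymptoticallyStable_of_cascade`). Invariance
follows from this bound, and existence from the Lipschitz property by gluing solutions. -/

theorem hasEigenvalue_of_mapQ {V : Type*} [AddCommGroup V] [Module ℂ V] {f : Module.End ℂ V}
    {v : V} {c : ℂ} (hv : f v = c • v) (hv0 : v ≠ 0)
    (h : ℂ ∙ v ≤ (ℂ ∙ v).comap f) {z : ℂ}
    (hz : Module.End.HasEigenvalue ((ℂ ∙ v).mapQ (ℂ ∙ v) f h) z) : f.HasEigenvalue z := by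
  by_cases hzc : z = c
  · subst hzc
    exact Module.End.hasEigenvalue_of_hasEigenvector
      (x := v) ⟨Module.End.mem_eigenspace_iff.2 hv, hv0⟩
  obtain ⟨y, hy⟩ := hz.exists_hasEigenvector
  obtain ⟨u, rfl⟩ := Submodule.mkQ_surjective _ y
  have h1 := hy.apply_eq_smul
  have h2 : f u - z • u ∈ (ℂ ∙ v) := by
    rw [← Submodule.Quotient.mk_eq_zero, Submodule.Quotient.mk_sub, Submodule.Quotient.mk_smul]
    simpa [sub_eq_zero] using h1
  obtain ⟨s, hs⟩ := Submodule.mem_span_singleton.1 h2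
  have hzc' : z - c ≠ 0 := sub_ne_zero.2 hzc
  -- Since `f u = z • u + s • v`, the correction `α • v` of the lift `u` must satisfy `s + α * c = z
  -- * α`.
  refine Module.End.hasEigenvalue_of_hasEigenvector (x := u + (s / (z - c)) • v)
    ⟨Module.End.mem_eigenspace_iff.2 ?_, ?_⟩
  · have hfu : f u = s • v + z • u := by rw [hs]; abel
    have hs' : s = (s / (z - c)) * z - (s / (z - c)) * c := by field_simp
    rw [map_add, map_smul, hfu, hv]
    nth_rewrite 1 [hs']
    module
  · intro h0
    apply hy.2
    have : u = -(s / (z - c)) • v := by rw [neg_smul]; exact eq_neg_of_add_eq_zero_left h0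
    rw [Submodule.mkQ_apply, Submodule.Quotient.mk_eq_zero, this]
    exact Submodule.smul_mem _ _ (Submodule.mem_span_singleton_self v)

/-- Triangularization with a rescaled flag: split off an eigenvector `v`, use the inductive
coordinates on the quotient by its line, and add a coordinate `l` along `v` with a small weight `η`.
The diagonal terms have real part at least `μ`, and the weight makes the off-diagonal coupling as
small as desired; hence the arbitrary loss `δ`, half of which is left to the induction. -/
theorem exists_accretive_coordinates (n : ℕ) {V : Type*} [AddCommGroup V] [Module ℂ V]
    [FiniteDimensional ℂ V] (hn : Module.finrank ℂ V = n) (f : Module.End ℂ V) {μ : ℝ}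
    (hf : ∀ z, f.HasEigenvalue z → μ ≤ z.re) {δ : ℝ} (hδ : 0 < δ) :
    ∃ Q : V →ₗ[ℂ] (Fin n → ℂ), Function.Injective Q ∧
      ∀ x, (μ - δ) * ∑ i, Complex.normSq (Q x i) ≤
        ∑ i, ((Q x i).re * (Q (f x) i).re + (Q x i).im * (Q (f x) i).im) := by
  induction n generalizing V δ with
  | zero =>
    have : Subsingleton V := Module.finrank_zero_iff.1 hn
    exact ⟨0, fun x y _ => Subsingleton.elim x y, fun x => by simp⟩
  | succ n ih =>
    have : Nontrivial V := Module.nontrivial_of_finrank_pos (R := ℂ) (by omega)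
    obtain ⟨c, hc⟩ := Module.End.exists_eigenvalue f
    obtain ⟨v, hv⟩ := hc.exists_hasEigenvector
    have hfv := hv.apply_eq_smul
    have hinv : ℂ ∙ v ≤ (ℂ ∙ v).comap f := by
      rw [Submodule.span_singleton_le_iff_mem, Submodule.mem_comap, hfv]
      exact Submodule.smul_mem _ _ (Submodule.mem_span_singleton_self v)
    have hfin : Module.finrank ℂ (V ⧸ (ℂ ∙ v)) = n := by
      have h1 := Submodule.finrank_quotient_add_finrank (ℂ ∙ v)
      rw [finrank_span_singleton hv.2] at h1
      omega
    obtain ⟨Q, hQ, hQf⟩ := ih hfin ((ℂ ∙ v).mapQ (ℂ ∙ v) f hinv)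
      (fun z hz => hf z (hasEigenvalue_of_mapQ hfv hv.2 hinv hz)) (half_pos hδ)
    obtain ⟨l, hl⟩ : ∃ l : V →ₗ[ℂ] ℂ, l v = 1 := by
      have h1 : ¬ ∀ l : Module.Dual ℂ V, l v = 0 := fun h =>
        hv.2 ((Module.forall_dual_apply_eq_zero_iff ℂ v).1 h)
      push Not at h1
      obtain ⟨l, hl⟩ := h1
      exact ⟨(l v)⁻¹ • l, by simp [hl]⟩
    obtain ⟨Q', hQ'⟩ := LinearMap.exists_leftInverse_of_injective Q (LinearMap.ker_eq_bot.2 hQ)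
    -- The off-diagonal part of `f` kills `v`, so it descends to the quotient and, through the left
    -- inverse `Q'`, becomes a functional `k` of the inductive coordinates.
    let r : V →ₗ[ℂ] ℂ := l ∘ₗ f - c • l
    have hr : ℂ ∙ v ≤ LinearMap.ker r := by
      rw [Submodule.span_singleton_le_iff_mem, LinearMap.mem_ker]
      simp [r, hfv, hl]
    let k : (Fin n → ℂ) →L[ℂ] ℂ := LinearMap.toContinuousLinearMap ((ℂ ∙ v).liftQ r hr ∘ₗ Q')
    let π := (ℂ ∙ v).mkQ
    have hk : ∀ x, l (f x) = c * l x + k (Q (π x)) := by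
      intro x
      have h1 : Q' (Q (π x)) = π x := LinearMap.congr_fun hQ' (π x)
      have h2 : k (Q (π x)) = r x := by
        change (ℂ ∙ v).liftQ r hr (Q' (Q (π x))) = r x
        rw [h1]; simp [π]
      rw [h2]; simp [r]
    have hη : 0 < δ / (‖k‖ + 1) := by positivity
    set η : ℝ := δ / (‖k‖ + 1) with hηdef
    have hηk : η * ‖k‖ ≤ δ := by
      rw [hηdef, div_mul_eq_mul_div, div_le_iff₀ (by positivity)]
      nlinarith [norm_nonneg k]
    refine ⟨LinearMap.vecCons ((η : ℂ) • l) (Q ∘ₗ π), ?_, ?_⟩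
    · rw [← LinearMap.ker_eq_bot, LinearMap.ker_eq_bot']
      intro x hx
      have h0 : (η : ℂ) * l x = 0 := by simpa using congrFun hx 0
      have h1 : Q (π x) = 0 := by
        ext i; simpa using congrFun hx i.succ
      have h2 : π x = 0 := hQ (by rw [h1, map_zero])
      have h3 : x ∈ ℂ ∙ v := by simpa [π] using h2
      obtain ⟨s, rfl⟩ := Submodule.mem_span_singleton.1 h3
      have : s = 0 := by simpa [hl, hη.ne'] using h0
      simp [this]
    · intro x
      have hIH := hQf (π x)
      have hπ : ((ℂ ∙ v).mapQ (ℂ ∙ v) f hinv) (π x) = π (f x) := by simp [π]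
      rw [hπ] at hIH
      rw [Fin.sum_univ_succ, Fin.sum_univ_succ]
      simp only [LinearMap.vecCons_apply, Matrix.cons_val_zero, Matrix.cons_val_succ,
        LinearMap.smul_apply, LinearMap.comp_apply, smul_eq_mul, hk x]
      set q := Q (π x)
      have hs : ‖q‖ ^ 2 ≤ ∑ i, Complex.normSq (q i) := by
        have h0 : 0 ≤ ∑ i, Complex.normSq (q i) :=
          Finset.sum_nonneg fun i _ => Complex.normSq_nonneg _
        rw [← Real.le_sqrt (norm_nonneg _) h0]
        refine (pi_norm_le_iff_of_nonneg (Real.sqrt_nonneg _)).2 fun i => ?_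
        rw [Real.le_sqrt (norm_nonneg _) h0, ← Complex.normSq_eq_norm_sq]
        exact Finset.single_le_sum (f := fun i => Complex.normSq (q i))
          (fun i _ => Complex.normSq_nonneg _) (Finset.mem_univ i)
      have hc' := hf c hc
      have hkq : ‖k q‖ ≤ ‖k‖ * ‖q‖ := k.le_opNorm q
      have hcs : -(‖l x‖ * ‖k q‖) ≤ (l x).re * (k q).re + (l x).im * (k q).im := by
        have h1 : ((starRingEnd ℂ) (l x) * k q).re = (l x).re * (k q).re + (l x).im * (k q).im := by
          simp
        rw [← h1]
        have h2 := Complex.abs_re_le_norm ((starRingEnd ℂ) (l x) * k q)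
        rw [norm_mul, Complex.norm_conj] at h2
        exact (abs_le.1 h2).1
      have hA : (l x).re * (l x).re + (l x).im * (l x).im = ‖l x‖ ^ 2 := by
        rw [← Complex.normSq_eq_norm_sq, Complex.normSq_apply]
      have h3 : ‖l x‖ * ‖k q‖ ≤ ‖l x‖ * (‖k‖ * ‖q‖) := by gcongr
      have h4 : (η * ‖k‖) * ((η * ‖l x‖) * ‖q‖) ≤ δ * ((η * ‖l x‖) * ‖q‖) := by gcongr
      have h5 : η ^ 2 * (-(‖l x‖ * (‖k‖ * ‖q‖))) ≤
          η ^ 2 * ((l x).re * (k q).re + (l x).im * (k q).im) := by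
        gcongr; linarith
      have h6 : η ^ 2 * (μ * ‖l x‖ ^ 2) ≤ η ^ 2 * (c.re * ‖l x‖ ^ 2) := by gcongr
      -- Young's inequality: the coupling, at most `δ * (η ‖l x‖) * ‖q‖`, is absorbed by `δ` times
      -- the square of the new coordinate and part of the spare `δ / 2` on the old ones.
      have h7 : 0 ≤ δ * (η * ‖l x‖ - ‖q‖ / 2) ^ 2 := by positivity
      have h8 : δ / 2 * ‖q‖ ^ 2 ≤ δ / 2 * ∑ i, Complex.normSq (q i) := by gcongr
      have h9 : (↑η * l x).re * (↑η * (c * l x + k q)).re +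
          (↑η * l x).im * (↑η * (c * l x + k q)).im =
          η ^ 2 * (c.re * ‖l x‖ ^ 2) + η ^ 2 * ((l x).re * (k q).re + (l x).im * (k q).im) := by
        rw [← hA]; simp; ring
      have h10 : Complex.normSq (↑η * l x) = η ^ 2 * ‖l x‖ ^ 2 := by
        rw [Complex.normSq_mul, Complex.normSq_ofReal, Complex.normSq_eq_norm_sq]; ring
      rw [h9, h10]
      have h11 : 0 ≤ δ * ‖q‖ ^ 2 := by positivity
      nlinarith

/-- A real matrix whose complex eigenvalues have real part at least `μ` is, up to `δ`, accretive
in a suitable Euclidean structure, given by an injective matrix `R`. -/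
theorem exists_accretive_matrix {n : ℕ} (M : Matrix (Fin n) (Fin n) ℝ) {μ : ℝ}
    (hM : ∀ z ∈ spectrum ℂ (M.map (fun x : ℝ => (x : ℂ))), μ ≤ z.re) {δ : ℝ} (hδ : 0 < δ) :
    ∃ R : Matrix (Fin n ⊕ Fin n) (Fin n) ℝ, (∀ x, R *ᵥ x = 0 → x = 0) ∧
      ∀ x, (μ - δ) * (R *ᵥ x ⬝ᵥ R *ᵥ x) ≤ R *ᵥ x ⬝ᵥ R *ᵥ (M *ᵥ x) := by
  obtain ⟨Q, hQ, hQM⟩ := exists_accretive_coordinates n (by simp)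
    (Matrix.toLin' (M.map (fun x : ℝ => (x : ℂ)))) (μ := μ) (fun z hz => hM z (by
      rw [Module.End.hasEigenvalue_iff_mem_spectrum] at hz
      rwa [Matrix.spectrum_toLin'] at hz)) hδ
  let q := LinearMap.toMatrix' Q
  -- Stacking real and imaginary parts turns the Hermitian expressions, evaluated at real vectors,
  -- into real dot products.
  let R : Matrix (Fin n ⊕ Fin n) (Fin n) ℝ :=
    Matrix.fromRows (q.map Complex.re) (q.map Complex.im)
  have hq : ∀ (x : Fin n → ℝ) i, Q (fun j => (x j : ℂ)) i =
      ⟨(R *ᵥ x) (Sum.inl i), (R *ᵥ x) (Sum.inr i)⟩ := by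
    intro x i
    have h1 : Q (fun j => (x j : ℂ)) = q *ᵥ (fun j => (x j : ℂ)) := by
      rw [← Matrix.toLin'_apply, Matrix.toLin'_toMatrix']
    rw [h1]
    apply Complex.ext <;> simp [R, Matrix.mulVec, dotProduct, Matrix.fromRows] <;> rfl
  refine ⟨R, fun x hx => ?_, fun x => ?_⟩
  · have h1 : Q (fun j => (x j : ℂ)) = 0 := by
      ext i
      rw [hq, hx]; rfl
    have h2 := hQ (h1.trans (map_zero Q).symm)
    ext j
    simpa using congrFun h2 j
  · have h1 := hQM (fun j => (x j : ℂ))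
    have h2 : (Matrix.toLin' (M.map (fun x : ℝ => (x : ℂ)))) (fun j => (x j : ℂ)) =
        fun j => (((M *ᵥ x) j : ℝ) : ℂ) := by
      ext j
      simp [Matrix.toLin'_apply, Matrix.mulVec, dotProduct]
    rw [h2] at h1
    simp only [hq, Complex.normSq_apply, Finset.sum_add_distrib] at h1
    simpa [dotProduct, Fintype.sum_sum_type] using h1

/-! ### The Laplacian of a connected topology -/

theorem CommTopology.laplacian_mulVec {N : ℕ} (G : CommTopology N) (x : Fin N → ℝ) (k : Fin N) :
    (G.laplacian *ᵥ x) k = ∑ j, G.adj k j * (x k - x j) := by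
  have h : ∀ j, G.laplacian k j * x j =
      (if k = j then (∑ m, G.adj k m) * x k else 0) - G.adj k j * x j := by
    intro j
    by_cases hkj : k = j
    · subst hkj; simp [laplacian, G.adj_self]
    · simp [laplacian, hkj]
  simp only [Matrix.mulVec, dotProduct, h, Finset.sum_sub_distrib, mul_sub]
  simp [Finset.sum_mul]

theorem CommTopology.nonneg_of_laplacian_eq {N : ℕ} {G : CommTopology N} {x : Fin N → ℝ}
    {c : ℝ} (hx : ∀ k, ∑ j, G.adj k j * (x k - x j) = c) (hN : 0 < N) : 0 ≤ c := by
  have : Nonempty (Fin N) := ⟨⟨0, hN⟩⟩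
  obtain ⟨k, hk⟩ := Finite.exists_max x
  rw [← hx k]
  exact Finset.sum_nonneg fun j _ => mul_nonneg (G.adj_nonneg _ _) (sub_nonneg.2 (hk j))

/-- Maximum principle: at a node where the maximum is attained all summands are nonnegative, hence
zero, so its in-neighbours attain the maximum too. Following a path backwards carries the maximum to
the root. -/
theorem CommTopology.le_root_of_harmonic {N : ℕ} {G : CommTopology N} {x : Fin N → ℝ}
    (hx : ∀ k, ∑ j, G.adj k j * (x k - x j) = 0) {v : Fin N}
    (hv : ∀ k, Relation.ReflTransGen (fun j k => 0 < G.adj k j) v k) (k : Fin N) : x k ≤ x v := by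
  have : Nonempty (Fin N) := ⟨v⟩
  obtain ⟨m, hm⟩ := Finite.exists_max x
  refine (hm k).trans (le_of_eq ?_)
  have hm' := hv m
  clear hv
  induction hm' using Relation.ReflTransGen.head_induction_on with
  | refl => rfl
  | @head i j hij _ ih =>
    have h1 : ∀ l ∈ Finset.univ, 0 ≤ G.adj j l * (x j - x l) := fun l _ =>
      mul_nonneg (G.adj_nonneg _ _) (sub_nonneg.2 (ih ▸ hm l))
    have h2 := (Finset.sum_eq_zero_iff_of_nonneg h1).1 (hx j) i (Finset.mem_univ i)
    rcases mul_eq_zero.1 h2 with h | h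
    · exact absurd h hij.ne'
    · rw [ih]; linarith

/-- Maxima of `x` and of `-x` force `c = 0`; the maximum principle for both then gives constancy.
Allowing `c ≠ 0` in the hypothesis also rules out a Jordan block of the Laplacian at zero. -/
theorem CommTopology.Connected.eq_of_laplacian {N : ℕ} {G : CommTopology N} (hG : G.Connected)
    {x : Fin N → ℝ} {c : ℝ} (hx : ∀ k, ∑ j, G.adj k j * (x k - x j) = c) (j k : Fin N) :
    x j = x k := by
  have hN : 0 < N := j.pos
  have hneg : ∀ k, ∑ j, G.adj k j * ((-x) k - (-x) j) = -c := by
    intro k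
    rw [← hx k, ← Finset.sum_neg_distrib]
    exact Finset.sum_congr rfl fun j _ => by simp; ring
  have h1 := nonneg_of_laplacian_eq hx hN
  have h2 := nonneg_of_laplacian_eq hneg hN
  have hc : c = 0 := by linarith
  subst hc
  rw [neg_zero] at hneg
  obtain ⟨v, hv⟩ := hG
  have h3 : ∀ k, x k = x v := fun k => le_antisymm (le_root_of_harmonic hx hv k)
    (neg_le_neg_iff.1 (le_root_of_harmonic hneg hv k))
  rw [h3 j, h3 k]

/-- The action of the Laplacian on disagreements relative to the node `o`, extended by `μ` to
the consensus direction. -/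
def CommTopology.reducedLaplacian {N : ℕ} (G : CommTopology N) (o : Fin N) (μ : ℝ) :
    Matrix (Fin N) (Fin N) ℝ :=
  Matrix.of fun k j => G.laplacian k j - G.laplacian o j + if j = o then μ else 0

/-- Row `o` of the eigenvalue equation reads `μ * x o = z * x o`, so `z = μ` unless `x o = 0`. In
that case, if `z ≠ 0`, adding the constant `(L x) o / z` to `x` produces an eigenvector of the
Laplacian itself and the spectral bound applies; if `z = 0`, then `L x` is constant, which by
connectedness makes `x` constant, hence zero. -/
theorem CommTopology.Connected.le_re_of_mem_spectrum {N : ℕ} {G : CommTopology N}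
    (hG : G.Connected) {μ : ℝ} (hμ : G.SpectralBound μ) (o : Fin N) {z : ℂ}
    (hz : z ∈ spectrum ℂ ((G.reducedLaplacian o μ).map (fun x : ℝ => (x : ℂ)))) : μ ≤ z.re := by
  set L : Matrix (Fin N) (Fin N) ℂ := G.laplacian.map (fun x : ℝ => (x : ℂ)) with hL
  rw [← Matrix.spectrum_toLin', ← Module.End.hasEigenvalue_iff_mem_spectrum] at hz
  obtain ⟨x, hx⟩ := hz.exists_hasEigenvector
  have hx0 := hx.2
  have hxz : ∀ k, (L *ᵥ x) k - (L *ᵥ x) o + μ * x o = z * x k := by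
    intro k
    have h1 := congrFun hx.apply_eq_smul k
    rw [Matrix.toLin'_apply, Pi.smul_apply, smul_eq_mul] at h1
    rw [← h1]
    have h2 : ∀ j, (G.reducedLaplacian o μ).map (fun x : ℝ => (x : ℂ)) k j * x j =
        L k j * x j - L o j * x j + if j = o then μ * x o else 0 := by
      intro j
      by_cases hj : j = o
      · subst hj; simp [reducedLaplacian, hL]; ring
      · simp [reducedLaplacian, hL, hj]; ring
    simp only [Matrix.mulVec, dotProduct, h2, Finset.sum_add_distrib, Finset.sum_sub_distrib]
    simp
  by_cases ho : x o = 0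
  · have hconst : ∀ c : ℂ, L *ᵥ (fun _ => c) = 0 := by
      intro c
      ext k
      have h1 := G.laplacian_mulVec (fun _ => 1) k
      simp only [sub_self, mul_zero, Finset.sum_const_zero, Matrix.mulVec, dotProduct,
        mul_one] at h1
      have h2 : ∑ j, L k j = 0 := by
        simp only [hL, Matrix.map_apply]; exact_mod_cast congrArg (fun x : ℝ => (x : ℂ)) h1
      simp [Matrix.mulVec, dotProduct, ← Finset.sum_mul, h2]
    by_cases hz0 : z = 0
    · exfalso
      apply hx0
      have h1 : ∀ k, (L *ᵥ x) k = (L *ᵥ x) o := by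
        intro k
        have := hxz k
        rw [ho, hz0] at this
        linear_combination this
      have hre : ∀ k, ∑ j, G.adj k j * ((x k).re - (x j).re) = ((L *ᵥ x) o).re := by
        intro k
        rw [← h1 k, ← G.laplacian_mulVec (fun k => (x k).re)]
        simp [Matrix.mulVec, dotProduct, hL]
      have him : ∀ k, ∑ j, G.adj k j * ((x k).im - (x j).im) = ((L *ᵥ x) o).im := by
        intro k
        rw [← h1 k, ← G.laplacian_mulVec (fun k => (x k).im)]
        simp [Matrix.mulVec, dotProduct, hL]
      ext k
      rw [Pi.zero_apply, ← ho]
      exact Complex.ext (hG.eq_of_laplacian hre k o) (hG.eq_of_laplacian him k o)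
    · refine hμ z ?_ hz0
      change z ∈ spectrum ℂ L
      rw [← Matrix.spectrum_toLin', ← Module.End.hasEigenvalue_iff_mem_spectrum]
      refine Module.End.hasEigenvalue_of_hasEigenvector
        (x := x + fun _ => (L *ᵥ x) o / z) ⟨Module.End.mem_eigenspace_iff.2 ?_, fun h => ?_⟩
      · rw [Matrix.toLin'_apply, Matrix.mulVec_add, hconst, add_zero]
        ext k
        have := hxz k
        rw [ho] at this
        simp only [Pi.smul_apply, Pi.add_apply, smul_eq_mul, mul_add, mul_div_cancel₀ _ hz0]
        linear_combination this
      · have h1 := congrFun h o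
        simp only [Pi.add_apply, ho, zero_add, Pi.zero_apply] at h1
        apply hx0
        ext k
        simpa [h1] using congrFun h k
  · have h1 := hxz o
    rw [sub_self, zero_add] at h1
    have h2 : (μ : ℂ) = z := mul_right_cancel₀ ho h1
    rw [← h2]; simp

/-! ### Exponential estimates from quadratic Lyapunov functions -/

theorem exists_pos_mul_sq_norm_le {E : Type*} [NormedAddCommGroup E] [NormedSpace ℝ E]
    [FiniteDimensional ℝ E] {q : E → ℝ} (hq : Continuous q)
    (hsmul : ∀ (c : ℝ) x, q (c • x) = c ^ 2 * q x) (hpos : ∀ x, x ≠ 0 → 0 < q x) :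
    ∃ m, 0 < m ∧ ∀ x, m * ‖x‖ ^ 2 ≤ q x := by
  have h0 : q 0 = 0 := by simpa using hsmul 0 0
  cases subsingleton_or_nontrivial E with
  | inl h => exact ⟨1, one_pos, fun x => by rw [Subsingleton.elim x 0, h0]; simp⟩
  | inr h =>
    have : ProperSpace E := FiniteDimensional.proper ℝ E
    obtain ⟨y, hy, hmin⟩ := (isCompact_sphere (0 : E) 1).exists_isMinOn
      (NormedSpace.sphere_nonempty.2 zero_le_one) hq.continuousOn
    have hy0 : y ≠ 0 := by
      rintro rfl
      simp at hy
    refine ⟨q y, hpos y hy0, fun x => ?_⟩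
    by_cases hx : x = 0
    · rw [hx, h0]; simp
    have hx' : 0 < ‖x‖ := norm_pos_iff.2 hx
    have h1 : q y ≤ q (‖x‖⁻¹ • x) := hmin (by simp [norm_smul, hx'.ne'])
    calc q y * ‖x‖ ^ 2 ≤ q (‖x‖⁻¹ • x) * ‖x‖ ^ 2 := by gcongr
      _ = q x := by rw [hsmul]; field_simp

theorem le_exp_mul_of_deriv_le {V V' : ℝ → ℝ} {k t₀ t₁ : ℝ}
    (hV : ∀ t ∈ Set.Icc t₀ t₁, HasDerivWithinAt V (V' t) (Set.Icc t₀ t₁) t)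
    (hk : ∀ t ∈ Set.Icc t₀ t₁, V' t ≤ -k * V t) {t : ℝ} (ht : t ∈ Set.Icc t₀ t₁) :
    V t ≤ Real.exp (-k * (t - t₀)) * V t₀ := by
  have hder : ∀ s ∈ Set.Icc t₀ t₁, HasDerivWithinAt (fun s => V s * Real.exp (k * (s - t₀)))
      (V' s * Real.exp (k * (s - t₀)) + V s * (Real.exp (k * (s - t₀)) * (k * 1)))
      (Set.Icc t₀ t₁) s := fun s hs =>
    (hV s hs).mul ((((hasDerivWithinAt_id s _).sub_const t₀).const_mul k).exp)
  have hanti : AntitoneOn (fun s => V s * Real.exp (k * (s - t₀))) (Set.Icc t₀ t₁) := by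
    refine antitoneOn_of_hasDerivWithinAt_nonpos (convex_Icc _ _)
      (fun s hs => (hder s hs).continuousWithinAt)
      (fun s hs => (hder s (interior_subset hs)).mono interior_subset) fun s hs => ?_
    have h1 := hk s (interior_subset hs)
    have h2 := Real.exp_pos (k * (s - t₀))
    nlinarith
  have h := hanti (Set.left_mem_Icc.2 (ht.1.trans ht.2)) ht ht.1
  simp only [sub_self, mul_zero, Real.exp_zero, mul_one] at h
  calc V t = Real.exp (-k * (t - t₀)) * (V t * Real.exp (k * (t - t₀))) := by
        rw [mul_comm (V t), ← mul_assoc, ← Real.exp_add]; simp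
    _ ≤ _ := by gcongr

/-- The order of the quantifiers matters: `M` and `κ` come from the form and the linear map alone,
and only the threshold for `g` depends on the size `c` of the perturbation. -/
theorem exists_exponential_decay {E : Type*} [NormedAddCommGroup E] [NormedSpace ℝ E]
    [FiniteDimensional ℝ E] (b : E →ₗ[ℝ] E →ₗ[ℝ] ℝ) (A : E →ₗ[ℝ] E)
    (hsymm : ∀ x y, b x y = b y x) (hpos : ∀ x, x ≠ 0 → 0 < b x x)
    (hneg : ∀ x, x ≠ 0 → b x (A x) < 0) :
    ∃ M κ : ℝ, 1 ≤ M ∧ 0 < κ ∧ ∀ c : ℝ, 0 ≤ c → ∃ g₀ : ℝ, ∀ g, g₀ ≤ g →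
      ∀ (X p : ℝ → E) (t₀ t₁ : ℝ),
      (∀ t ∈ Set.Icc t₀ t₁, HasDerivWithinAt X (g • A (X t) + p t) (Set.Icc t₀ t₁) t) →
      (∀ t ∈ Set.Icc t₀ t₁, ‖p t‖ ≤ c * ‖X t‖) → ∀ t ∈ Set.Icc t₀ t₁,
        ‖X t‖ ≤ M * Real.exp (-(g * κ) * (t - t₀)) * ‖X t₀‖ := by
  let b' : E →L[ℝ] E →L[ℝ] ℝ := b.toContinuousBilinearMap
  let A' : E →L[ℝ] E := LinearMap.toContinuousLinearMap A
  have hb' : ∀ x y, b' x y = b x y := fun x y => rfl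
  obtain ⟨m₁, hm₁, hm₁'⟩ := exists_pos_mul_sq_norm_le (q := fun x => b' x x) (by fun_prop)
    (fun c x => by simp; ring) hpos
  obtain ⟨m₂, hm₂, hm₂'⟩ := exists_pos_mul_sq_norm_le (q := fun x => -(b' x (A' x)))
    (by fun_prop) (fun c x => by simp; ring) (fun x hx => neg_pos.2 (hneg x hx))
  set D : ℝ := ‖b'‖ + 1
  have hD : 0 < D := by positivity
  have hbD : ∀ x y, b' x y ≤ D * (‖x‖ * ‖y‖) := by
    intro x y
    have h1 := (Real.le_norm_self _).trans (b'.le_opNorm₂ x y)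
    have h2 : 0 ≤ ‖x‖ * ‖y‖ := by positivity
    simp only [D]
    linarith [mul_assoc ‖b'‖ ‖x‖ ‖y‖]
  -- Half of the dissipation `2 * g * m₂ * ‖X‖ ^ 2` absorbs the perturbation once `g * m₂ ≥ 2 * D *
  -- c`. The other half gives `V` the rate `g * m₂ / D`, hence the norm half that rate. The `+ 1`
  -- ensures `1 ≤ M`.
  refine ⟨√(D / m₁) + 1, m₂ / (2 * D), by linarith [Real.sqrt_nonneg (D / m₁)], by positivity,
    fun c hc => ⟨max 0 (2 * D * c / m₂), fun g hg X p t₀ t₁ hX hp t ht => ?_⟩⟩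
  have hg0 : 0 ≤ g := (le_max_left _ _).trans hg
  have hgc : 2 * D * c ≤ g * m₂ := (div_le_iff₀ hm₂).1 ((le_max_right _ _).trans hg)
  have hV := le_exp_mul_of_deriv_le (k := g * (m₂ / D)) (V := fun t => b' (X t) (X t))
    (V' := fun t => b' (X t) (g • A (X t) + p t) + b' (g • A (X t) + p t) (X t))
    (t₀ := t₀) (t₁ := t₁)
    (fun s hs => ((b'.hasDerivWithinAt_of_bilinear (hX s hs) (hX s hs))))
    (fun s hs => by
      have h1 := hm₂' (X s)
      have h2 := hbD (X s) (p s)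
      have h3 := hbD (X s) (X s)
      have h4 : ‖X s‖ * ‖p s‖ ≤ ‖X s‖ * (c * ‖X s‖) := by gcongr; exact hp s hs
      have h5 : b' (g • A (X s) + p s) (X s) = b' (X s) (g • A (X s) + p s) := hsymm _ _
      have h6 : b' (X s) (g • A (X s) + p s) = g * b' (X s) (A' (X s)) + b' (X s) (p s) := by
        simp [A']
      rw [h5, h6]
      have h7 : g * (m₂ / D) * b' (X s) (X s) ≤ g * (m₂ / D) * (D * (‖X s‖ * ‖X s‖)) := by
        gcongr
      have h8 : g * (m₂ / D) * (D * (‖X s‖ * ‖X s‖)) = g * (m₂ * ‖X s‖ ^ 2) := by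
        field_simp
      have h9 : g * (m₂ * ‖X s‖ ^ 2) ≤ g * -(b' (X s) (A' (X s))) := by gcongr
      have h10 : D * (‖X s‖ * ‖p s‖) ≤ D * (‖X s‖ * (c * ‖X s‖)) := by gcongr
      have h11 : 2 * D * c * ‖X s‖ ^ 2 ≤ g * m₂ * ‖X s‖ ^ 2 := by gcongr
      nlinarith) ht
  have h1 : m₁ * ‖X t‖ ^ 2 ≤ Real.exp (-(g * (m₂ / D)) * (t - t₀)) * (D * (‖X t₀‖ * ‖X t₀‖)) :=
    (hm₁' (X t)).trans (hV.trans (by gcongr; exact hbD _ _))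
  have h2 : ‖X t‖ ^ 2 ≤ (√(D / m₁) * Real.exp (-(g * (m₂ / (2 * D))) * (t - t₀)) * ‖X t₀‖) ^ 2 := by
    rw [mul_pow, mul_pow, Real.sq_sqrt (by positivity), ← Real.exp_nat_mul]
    have h3 : ((2 : ℕ) : ℝ) * (-(g * (m₂ / (2 * D))) * (t - t₀)) =
        -(g * (m₂ / D)) * (t - t₀) := by
      push_cast; field_simp
    rw [h3]
    rw [← le_div_iff₀' hm₁] at h1
    exact h1.trans (le_of_eq (by ring))
  have h3 := abs_le_of_sq_le_sq h2 (by positivity)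
  rw [abs_of_nonneg (norm_nonneg _)] at h3
  refine h3.trans ?_
  gcongr
  linarith

theorem norm_le_exp_mul_of_deriv {E : Type*} [NormedAddCommGroup E] [NormedSpace ℝ E]
    {X X' : ℝ → E} {k t₀ t₁ : ℝ}
    (hX : ∀ t ∈ Set.Icc t₀ t₁, HasDerivWithinAt X (X' t) (Set.Icc t₀ t₁) t)
    (hk : ∀ t ∈ Set.Icc t₀ t₁, ‖X' t‖ ≤ k * ‖X t‖) {t : ℝ} (ht : t ∈ Set.Icc t₀ t₁) :
    ‖X t‖ ≤ Real.exp (k * (t - t₀)) * ‖X t₀‖ := by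
  have h := norm_le_gronwallBound_of_norm_deriv_right_le (f := X) (f' := X') (δ := ‖X t₀‖)
    (K := k) (ε := 0) (a := t₀) (b := t₁) (fun s hs => (hX s hs).continuousWithinAt)
    (fun s hs => ((hX s ⟨hs.1, hs.2.le⟩).mono_of_mem_nhdsWithin
      (Icc_mem_nhdsGE_of_mem hs))) le_rfl
    (fun s hs => by simpa using hk s ⟨hs.1, hs.2.le⟩) t ht
  rwa [gronwallBound_ε0, mul_comm] at h

/-! ### The Lyapunov form of the disagreement dynamics -/

/-- The nominal disagreement dynamics, in scaled coordinates, for a reduced Laplacian `L`. -/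
def disagreementMap {d N : ℕ} (P : Matrix (Fin d) (Fin d) ℝ) (L : Matrix (Fin N) (Fin N) ℝ) :
    Matrix (Fin N) (Fin d) ℝ →ₗ[ℝ] Matrix (Fin N) (Fin d) ℝ where
  toFun X := X * (S d)ᵀ - L * X * (C d)ᵀ * (C d * P)
  map_add' X Y := by simp only [Matrix.add_mul, Matrix.mul_add]; abel
  map_smul' c X := by simp [smul_sub]

/-- The bilinear form `tr (R X Q (R Y)ᵀ)`. -/
def traceForm {d N : ℕ} {ι : Type*} [Fintype ι] (R : Matrix ι (Fin N) ℝ)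
    (Q : Matrix (Fin d) (Fin d) ℝ) :
    Matrix (Fin N) (Fin d) ℝ →ₗ[ℝ] Matrix (Fin N) (Fin d) ℝ →ₗ[ℝ] ℝ :=
  LinearMap.mk₂ ℝ (fun X Y => (R * X * Q * (R * Y)ᵀ).trace)
    (fun X Y Z => by simp [Matrix.mul_add, Matrix.add_mul])
    (fun c X Y => by simp)
    (fun X Y Z => by simp [Matrix.mul_add])
    (fun c X Y => by simp)

theorem traceForm_apply {d N : ℕ} {ι : Type*} [Fintype ι] (R : Matrix ι (Fin N) ℝ)
    (Q : Matrix (Fin d) (Fin d) ℝ) (X Y : Matrix (Fin N) (Fin d) ℝ) :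
    traceForm R Q X Y = (R * X * Q * (R * Y)ᵀ).trace := rfl

theorem traceForm_comm {d N : ℕ} {ι : Type*} [Fintype ι] (R : Matrix ι (Fin N) ℝ)
    {Q : Matrix (Fin d) (Fin d) ℝ} (hQ : Qᵀ = Q) (X Y : Matrix (Fin N) (Fin d) ℝ) :
    traceForm R Q X Y = traceForm R Q Y X := by
  rw [traceForm_apply, traceForm_apply, ← Matrix.trace_transpose]
  simp only [Matrix.transpose_mul, Matrix.transpose_transpose, hQ, Matrix.mul_assoc]

theorem trace_mul_transpose_eq_sum {m n : Type*} [Fintype m] [Fintype n] (A B : Matrix m n ℝ) :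
    (A * Bᵀ).trace = ∑ i, A i ⬝ᵥ B i := by
  simp [Matrix.trace, Matrix.mul_apply, dotProduct]

theorem mul_eq_zero_of_injective {d N : ℕ} {ι : Type*} [Fintype ι] {R : Matrix ι (Fin N) ℝ}
    (hR : ∀ x, R *ᵥ x = 0 → x = 0) {X : Matrix (Fin N) (Fin d) ℝ} (h : R * X = 0) : X = 0 := by
  ext k i
  have h1 : R *ᵥ (fun k => X k i) = 0 := by
    ext r
    exact congrFun (congrFun h r) i
  exact congrFun (hR _ h1) k

theorem traceForm_self_pos {d N : ℕ} {ι : Type*} [Fintype ι] {R : Matrix ι (Fin N) ℝ}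
    (hR : ∀ x, R *ᵥ x = 0 → x = 0) {Q : Matrix (Fin d) (Fin d) ℝ} (hQ : Q.PosDef)
    {X : Matrix (Fin N) (Fin d) ℝ} (hX : X ≠ 0) : 0 < traceForm R Q X X := by
  have hterm : ∀ r, (R * X * Q) r ⬝ᵥ (R * X) r = (R * X) r ⬝ᵥ Q *ᵥ (R * X) r := by
    intro r
    rw [Matrix.dotProduct_mulVec]
    rfl
  rw [traceForm_apply, trace_mul_transpose_eq_sum]
  simp only [hterm]
  have hnn : ∀ r, 0 ≤ (R * X) r ⬝ᵥ Q *ᵥ (R * X) r := fun r => by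
    simpa using hQ.posSemidef.dotProduct_mulVec_nonneg ((R * X) r)
  refine lt_of_le_of_ne (Finset.sum_nonneg fun r _ => hnn r) fun h => hX ?_
  apply mul_eq_zero_of_injective hR
  have h1 := (Finset.sum_eq_zero_iff_of_nonneg fun r _ => hnn r).1 h.symm
  funext r
  by_contra hr
  have h2 := hQ.dotProduct_mulVec_pos (x := (R * X) r) hr
  simp only [star_trivial] at h2
  exact absurd (h1 r (Finset.mem_univ r)) h2.ne'

theorem IsRiccatiSolution.inv_equation {d : ℕ} {P : Matrix (Fin d) (Fin d) ℝ} {μ a : ℝ}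
    (hP : IsRiccatiSolution P μ a) :
    P⁻¹ * S d + (S d)ᵀ * P⁻¹ = (2 * μ) • ((C d)ᵀ * C d) - a • (P⁻¹ * P⁻¹) := by
  have hu : IsUnit P.det := (Matrix.isUnit_iff_isUnit_det P).1 hP.posDef.isUnit
  have h := congrArg (fun M => P⁻¹ * M * P⁻¹) hP.equation
  simp only [Matrix.mul_add, Matrix.add_mul, Matrix.mul_sub, Matrix.sub_mul, Matrix.mul_zero,
    Matrix.zero_mul, Matrix.mul_smul, Matrix.smul_mul, Matrix.mul_one] at h
  have h1 : P⁻¹ * (S d * P) * P⁻¹ = P⁻¹ * S d := by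
    rw [← Matrix.mul_assoc, Matrix.mul_assoc _ P, Matrix.mul_nonsing_inv P hu, Matrix.mul_one]
  have h2 : P⁻¹ * (P * (S d)ᵀ) * P⁻¹ = (S d)ᵀ * P⁻¹ := by
    rw [← Matrix.mul_assoc, Matrix.nonsing_inv_mul P hu, Matrix.one_mul]
  have h3 : P⁻¹ * (P * (C d)ᵀ * C d * P) * P⁻¹ = (C d)ᵀ * C d := by
    rw [Matrix.mul_assoc P, Matrix.mul_assoc P, ← Matrix.mul_assoc P⁻¹,
      Matrix.nonsing_inv_mul P hu, Matrix.one_mul, Matrix.mul_assoc _ P,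
      Matrix.mul_nonsing_inv P hu, Matrix.mul_one]
  rw [h1, h2, h3] at h
  rw [← sub_eq_zero, ← h]
  abel

theorem trace_mul_sq_le {d : ℕ} {ι : Type*} [Fintype ι] (Y : Matrix ι (Fin d) ℝ)
    (p : Matrix (Fin d) (Fin 1) ℝ) :
    (Y * p * (Y * p)ᵀ).trace ≤ (∑ i, p i 0 ^ 2) * (Y * Yᵀ).trace := by
  rw [trace_mul_transpose_eq_sum, trace_mul_transpose_eq_sum, Finset.mul_sum]
  refine Finset.sum_le_sum fun r _ => ?_
  have h := Finset.sum_mul_sq_le_sq_mul_sq Finset.univ (Y r) (fun i => p i 0)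
  simp only [dotProduct, Fin.sum_univ_one, Matrix.mul_apply, Fin.isValue, ← pow_two]
  linarith

/-- Put `Z = R X` and `Y = Z P⁻¹`. The Riccati equation, multiplied by `P⁻¹` on both sides,
evaluates the drift term as `μ ‖Z Cᵀ‖² - (a / 2) ‖Y‖²`. In the coupling term `P` cancels `P⁻¹`,
leaving only the scalar outputs `X Cᵀ`, so accretivity of `L` bounds it below by `(μ - δ) ‖Z Cᵀ‖²`.
The terms in `μ` cancel. -/
theorem exists_lyapunov_form {d N : ℕ} {P : Matrix (Fin d) (Fin d) ℝ} {μ a : ℝ} (ha : 0 < a)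
    (hP : IsRiccatiSolution P μ a) {L : Matrix (Fin N) (Fin N) ℝ}
    (hL : ∀ z ∈ spectrum ℂ (L.map (fun x : ℝ => (x : ℂ))), μ ≤ z.re) :
    ∃ b : Matrix (Fin N) (Fin d) ℝ →ₗ[ℝ] Matrix (Fin N) (Fin d) ℝ →ₗ[ℝ] ℝ,
      (∀ X Y, b X Y = b Y X) ∧ (∀ X, X ≠ 0 → 0 < b X X) ∧
      ∀ X, X ≠ 0 → b X (disagreementMap P L X) < 0 := by
  have hu : IsUnit P.det := (Matrix.isUnit_iff_isUnit_det P).1 hP.posDef.isUnit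
  have hPt : Pᵀ = P := by simpa using hP.posDef.isHermitian.eq
  have hPit : (P⁻¹)ᵀ = P⁻¹ := by rw [Matrix.transpose_nonsing_inv, hPt]
  set K : ℝ := ∑ i, (P * (C d)ᵀ) i 0 ^ 2
  have hK : 0 ≤ K := Finset.sum_nonneg fun i _ => sq_nonneg _
  -- As `Z Cᵀ = Y P Cᵀ`, Cauchy–Schwarz gives `‖Z Cᵀ‖² ≤ K ‖Y‖²`; this `δ` satisfies `δ * K < a /
  -- 2`.
  obtain ⟨R, hR, hRL⟩ := exists_accretive_matrix L hL (δ := a / (2 * (K + 1))) (by positivity)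
  refine ⟨traceForm R P⁻¹, traceForm_comm R hPit, fun X hX => traceForm_self_pos hR hP.posDef.inv hX,
    fun X hX => ?_⟩
  set Z := R * X with hZ
  set Y := Z * P⁻¹ with hY
  have hYP : Y * P = Z := by
    rw [hY, Matrix.mul_assoc, Matrix.nonsing_inv_mul P hu, Matrix.mul_one]
  have hZC : Z * (C d)ᵀ = Y * (P * (C d)ᵀ) := by rw [← Matrix.mul_assoc, hYP]
  have hYpos : 0 < (Y * Yᵀ).trace := by
    rw [trace_mul_transpose_eq_sum]
    have hnn : ∀ r ∈ Finset.univ, 0 ≤ Y r ⬝ᵥ Y r := fun r _ =>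
      Finset.sum_nonneg fun i _ => mul_self_nonneg _
    refine lt_of_le_of_ne (Finset.sum_nonneg hnn) fun h => hX ?_
    have h1 := (Finset.sum_eq_zero_iff_of_nonneg hnn).1 h.symm
    have h2 : Y = 0 := by
      funext r
      exact dotProduct_self_eq_zero.1 (h1 r (Finset.mem_univ r))
    apply mul_eq_zero_of_injective hR
    rw [← hZ, ← hYP, h2, Matrix.zero_mul]
  have h1 := trace_mul_sq_le Y (P * (C d)ᵀ)
  rw [← hZC] at h1
  have hdrift : (Y * (Z * (S d)ᵀ)ᵀ).trace =
      μ * (Z * (C d)ᵀ * (Z * (C d)ᵀ)ᵀ).trace - a / 2 * (Y * Yᵀ).trace := by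
    have e1 : (Y * (Z * (S d)ᵀ)ᵀ).trace = (Z * (P⁻¹ * S d) * Zᵀ).trace := by
      rw [hY]; simp only [Matrix.transpose_mul, Matrix.transpose_transpose, Matrix.mul_assoc]
    have e2 : (Z * (P⁻¹ * S d) * Zᵀ).trace = (Z * ((S d)ᵀ * P⁻¹) * Zᵀ).trace := by
      rw [← Matrix.trace_transpose]
      simp only [Matrix.transpose_mul, Matrix.transpose_transpose, hPit, Matrix.mul_assoc]
    have e3 := congrArg (fun M => (Z * M * Zᵀ).trace) hP.inv_equation
    simp only [Matrix.mul_add, Matrix.add_mul, Matrix.mul_sub, Matrix.sub_mul, Matrix.mul_smul,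
      Matrix.smul_mul, Matrix.trace_add, Matrix.trace_sub, Matrix.trace_smul, smul_eq_mul,
      ← e2] at e3
    have e4 : (Z * (C d)ᵀ * (Z * (C d)ᵀ)ᵀ).trace = (Z * ((C d)ᵀ * C d) * Zᵀ).trace := by
      simp only [Matrix.transpose_mul, Matrix.transpose_transpose, Matrix.mul_assoc]
    have e5 : (Y * Yᵀ).trace = (Z * (P⁻¹ * P⁻¹) * Zᵀ).trace := by
      rw [hY]; simp only [Matrix.transpose_mul, hPit, Matrix.mul_assoc]
    rw [e1, e4, e5]
    linarith
  have hcoup : (μ - a / (2 * (K + 1))) * (Z * (C d)ᵀ * (Z * (C d)ᵀ)ᵀ).trace ≤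
      (Y * (R * (L * X * (C d)ᵀ * (C d * P)))ᵀ).trace := by
    have e1 : (Y * (R * (L * X * (C d)ᵀ * (C d * P)))ᵀ).trace =
        (Z * (C d)ᵀ * (R * (L * (X * (C d)ᵀ)))ᵀ).trace := by
      rw [hZC]
      simp only [Matrix.transpose_mul, Matrix.transpose_transpose, hPt, Matrix.mul_assoc]
    rw [e1, trace_mul_transpose_eq_sum, trace_mul_transpose_eq_sum]
    have h := hRL (fun k => (X * (C d)ᵀ) k 0)
    have e2 : Z * (C d)ᵀ = R * (X * (C d)ᵀ) := by rw [hZ, Matrix.mul_assoc]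
    have e3 : ∀ A B : Matrix (Fin N ⊕ Fin N) (Fin 1) ℝ,
        ∑ i, A i ⬝ᵥ B i = (fun i => A i 0) ⬝ᵥ (fun i => B i 0) := fun A B => by
      simp [dotProduct]
    rw [e2, e3, e3]
    exact h
  have hform : traceForm R P⁻¹ X (disagreementMap P L X) =
      (Y * (Z * (S d)ᵀ)ᵀ).trace - (Y * (R * (L * X * (C d)ᵀ * (C d * P)))ᵀ).trace := by
    rw [traceForm_apply, ← Matrix.trace_sub, ← Matrix.mul_sub, ← Matrix.transpose_sub, hZ,
      Matrix.mul_assoc R X (S d)ᵀ, ← Matrix.mul_sub]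
    rfl
  rw [hform, hdrift]
  have hlast : a / (2 * (K + 1)) * (Z * (C d)ᵀ * (Z * (C d)ᵀ)ᵀ).trace <
      a / 2 * (Y * Yᵀ).trace := by
    calc _ ≤ a / (2 * (K + 1)) * (K * (Y * Yᵀ).trace) := by gcongr
      _ = a / 2 * ((K / (K + 1)) * (Y * Yᵀ).trace) := by field_simp
      _ < a / 2 * (1 * (Y * Yᵀ).trace) := by
        gcongr
        rw [div_lt_one (by positivity)]; linarith
      _ = _ := by ring
  linarith

/-! ### Disagreement dynamics of the network -/

/-- The disagreements relative to the agent `o`, in high-gain coordinates. -/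
def scaledDisagreement {d N : ℕ} (o : Fin N) (g : ℝ) :
    (Fin N → AgentState d) →L[ℝ] (Fin N → Fin d → ℝ) :=
  LinearMap.toContinuousLinearMap
    { toFun := fun w k i => (w k i - w o i) / g ^ ((i : ℕ) + 1)
      map_add' := fun v w => by ext k i; simp; ring
      map_smul' := fun c w => by ext k i; simp; ring }

theorem scaledDisagreement_apply {d N : ℕ} (o : Fin N) (g : ℝ) (w : Fin N → AgentState d)
    (k : Fin N) (i : Fin d) :
    scaledDisagreement o g w k i = (w k i - w o i) / g ^ ((i : ℕ) + 1) := rfl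

theorem scaledDisagreement_const {d N : ℕ} (o : Fin N) (g : ℝ) (x : AgentState d) :
    scaledDisagreement o g (fun _ => x) = 0 := by
  ext k i
  simp [scaledDisagreement_apply]

theorem C_mulVec {d : ℕ} (hd : 0 < d) (x : Fin d → ℝ) (r : Fin 1) :
    (C d *ᵥ x) r = x ⟨0, hd⟩ := by
  have h : ∀ j : Fin d, ((j : ℕ) = 0) ↔ j = ⟨0, hd⟩ := fun j => by
    rw [Fin.ext_iff]
  simp [C, Matrix.mulVec, dotProduct, h]

theorem mul_C_transpose {d : ℕ} (hd : 0 < d) {m : Type*} (M : Matrix m (Fin d) ℝ) (k : m)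
    (r : Fin 1) : (M * (C d)ᵀ) k r = M k ⟨0, hd⟩ := by
  have h : ∀ j : Fin d, ((j : ℕ) = 0) ↔ j = ⟨0, hd⟩ := fun j => by
    rw [Fin.ext_iff]
  simp [C, Matrix.mul_apply, h]

theorem control_apply {d N : ℕ} (hd : 0 < d) (G : CommTopology N) (K : Matrix (Fin d) (Fin 1) ℝ)
    (w : Fin N → AgentState d) (k : Fin N) (i : Fin d) :
    control G K w k i = K i 0 * ∑ j, G.adj k j * (w j ⟨0, hd⟩ - w k ⟨0, hd⟩) := by
  simp only [control, ← Matrix.mulVec_sub]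
  simp [Matrix.mulVec, dotProduct, ← C_mulVec hd _ 0, mul_sub]

theorem drift_apply {d : ℕ} (φ : AgentState d → ℝ) (w : AgentState d) (i : Fin d) :
    drift φ w i = ∑ j, S d i j * w j + if (i : ℕ) + 1 = d then φ w else 0 := by
  simp [drift, B, Matrix.mulVec, dotProduct]

theorem gain_apply {d : ℕ} (hd : 0 < d) (P : Matrix (Fin d) (Fin d) ℝ) (g : ℝ) (i : Fin d) :
    gain P g i 0 = g ^ ((i : ℕ) + 1) * P i ⟨0, hd⟩ := by
  rw [gain, Matrix.diagonal_mul, mul_C_transpose hd]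

theorem CommTopology.reducedLaplacian_mulVec {N : ℕ} (G : CommTopology N) (o : Fin N) (μ : ℝ)
    {x : Fin N → ℝ} (hx : x o = 0) (k : Fin N) :
    (G.reducedLaplacian o μ *ᵥ x) k =
      ∑ j, G.adj k j * (x k - x j) - ∑ j, G.adj o j * (x o - x j) := by
  rw [← laplacian_mulVec, ← laplacian_mulVec]
  have h : ∀ j, G.reducedLaplacian o μ k j * x j =
      G.laplacian k j * x j - G.laplacian o j * x j := by
    intro j
    by_cases hj : j = o
    · subst hj; simp [hx]
    · simp [reducedLaplacian, hj, sub_mul]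
  simp [Matrix.mulVec, dotProduct, h]

/-- `disagreementMap` as a map of the normed space `Fin N → Fin d → ℝ`. -/
def disagreementField {d N : ℕ} (P : Matrix (Fin d) (Fin d) ℝ) (L : Matrix (Fin N) (Fin N) ℝ) :
    (Fin N → Fin d → ℝ) →ₗ[ℝ] (Fin N → Fin d → ℝ) := disagreementMap P L

/-- The contribution of the nonlinearity to the scaled disagreement dynamics. -/
def disagreementPerturbation {d N : ℕ} (φ : AgentState d → ℝ) (o : Fin N) (g : ℝ)
    (w : Fin N → AgentState d) : Fin N → Fin d → ℝ :=
  fun k i => (if (i : ℕ) + 1 = d then φ (w k) - φ (w o) else 0) / g ^ ((i : ℕ) + 1)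

/-- The shift lowers the index by one, which in scaled coordinates costs a factor `g`; the powers in
the gain cancel the scaling, and the outputs contribute another `g`. The disagreement of `o` with
itself vanishes, so the column of the reduced Laplacian that carries `μ` has no effect and `μ` is
arbitrary here. -/
theorem scaledDisagreement_networkField {d N : ℕ} (hd : 0 < d) (φ : AgentState d → ℝ)
    (G : CommTopology N) {P : Matrix (Fin d) (Fin d) ℝ} (hP : Pᵀ = P) (μ : ℝ) {g : ℝ} (hg : g ≠ 0)
    (o : Fin N) (w : Fin N → AgentState d) :
    scaledDisagreement o g (networkField φ G (gain P g) w) =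
      g • disagreementField P (G.reducedLaplacian o μ) (scaledDisagreement o g w) +
        disagreementPerturbation φ o g w := by
  set X := scaledDisagreement o g w with hX
  ext k i
  have hPz : (C d * P) 0 i = P i ⟨0, hd⟩ := by
    have h := C_mulVec hd (fun l => P l i) 0
    rw [← congrFun (congrFun hP i) ⟨0, hd⟩]
    exact h
  have hXo : X o ⟨0, hd⟩ = 0 := by simp [hX, scaledDisagreement_apply]
  have hgX : ∀ k j, g * (X k ⟨0, hd⟩ - X j ⟨0, hd⟩) = w k ⟨0, hd⟩ - w j ⟨0, hd⟩ := by
    intro k j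
    simp only [hX, scaledDisagreement_apply]
    field_simp
    ring
  have hcoup : g * (G.reducedLaplacian o μ * Matrix.of X * (C d)ᵀ * (C d * P)) k i
      = (∑ j, G.adj k j * (w k ⟨0, hd⟩ - w j ⟨0, hd⟩) -
        ∑ j, G.adj o j * (w o ⟨0, hd⟩ - w j ⟨0, hd⟩)) * P i ⟨0, hd⟩ := by
    rw [Matrix.mul_apply, Fin.sum_univ_one, hPz, mul_C_transpose hd, ← mul_assoc]
    congr 1
    have h := G.reducedLaplacian_mulVec o μ (x := fun k => X k ⟨0, hd⟩) hXo k
    change g * (G.reducedLaplacian o μ *ᵥ fun k => X k ⟨0, hd⟩) k = _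
    rw [h, mul_sub, Finset.mul_sum, Finset.mul_sum]
    simp only [← hgX, mul_left_comm g]
  have hshift : g * (Matrix.of X * (S d)ᵀ) k i =
      (∑ j, S d i j * w k j - ∑ j, S d i j * w o j) / g ^ ((i : ℕ) + 1) := by
    rw [Matrix.mul_apply, Finset.mul_sum, ← Finset.sum_sub_distrib, Finset.sum_div]
    refine Finset.sum_congr rfl fun j _ => ?_
    by_cases hij : (i : ℕ) + 1 = j
    · simp only [S, Matrix.transpose_apply, Matrix.of_apply, hij, if_true, hX,
        scaledDisagreement_apply]
      field_simp
      ring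
    · simp [S, hij]
  have hR : (g • disagreementField P (G.reducedLaplacian o μ) X +
        disagreementPerturbation φ o g w) k i =
      g * (Matrix.of X * (S d)ᵀ) k i -
      g * (G.reducedLaplacian o μ * Matrix.of X * (C d)ᵀ * (C d * P)) k i +
      disagreementPerturbation φ o g w k i := by
    rw [← mul_sub]; rfl
  have hneg : ∀ k, ∑ j, G.adj k j * (w j ⟨0, hd⟩ - w k ⟨0, hd⟩) =
      -∑ j, G.adj k j * (w k ⟨0, hd⟩ - w j ⟨0, hd⟩) := fun k => by
    rw [← Finset.sum_neg_distrib]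
    exact Finset.sum_congr rfl fun j _ => by ring
  rw [hR, hshift, hcoup]
  simp only [scaledDisagreement_apply, networkField, disagreementPerturbation, PiLp.add_apply,
    drift_apply, control_apply hd, gain_apply hd, hneg]
  by_cases hi : (i : ℕ) + 1 = d
  · simp only [hi, if_true]; field_simp; ring
  · simp only [hi, if_false]; field_simp; ring

theorem norm_le_card_mul_of_forall {d : ℕ} {x : AgentState d} {c : ℝ} (h : ∀ i, |x i| ≤ c) :
    ‖x‖ ≤ d * c := by
  have h1 : x = ∑ i, x i • EuclideanSpace.single i (1 : ℝ) := by
    ext j; simp [Finset.sum_apply, Pi.single_apply]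
  calc ‖x‖ = ‖∑ i, x i • EuclideanSpace.single i (1 : ℝ)‖ := by rw [← h1]
    _ ≤ ∑ i, ‖x i • EuclideanSpace.single i (1 : ℝ)‖ := norm_sum_le _ _
    _ ≤ ∑ _i : Fin d, c := Finset.sum_le_sum fun i _ => by simpa [norm_smul] using h i
    _ = d * c := by simp

theorem norm_sub_le_scaledDisagreement {d N : ℕ} {g : ℝ} (hg : 1 ≤ g) (o k : Fin N)
    (w : Fin N → AgentState d) :
    ‖w k - w o‖ ≤ d * (g ^ d * ‖scaledDisagreement o g w‖) := by
  refine norm_le_card_mul_of_forall fun i => ?_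
  have hg0 : 0 < g := by linarith
  have h1 : (w k - w o) i = g ^ ((i : ℕ) + 1) * scaledDisagreement o g w k i := by
    rw [scaledDisagreement_apply, PiLp.sub_apply]; field_simp
  have h2 : |scaledDisagreement o g w k i| ≤ ‖scaledDisagreement o g w‖ :=
    (norm_le_pi_norm (scaledDisagreement o g w k) i).trans (norm_le_pi_norm _ k)
  rw [h1, abs_mul, abs_of_pos (by positivity)]
  gcongr
  exact i.2

/-- The nonlinearity enters only the last component, where the scaling divides by `g ^ d`; this
cancels the factor `g ^ d` lost in bounding `w k - w o` by scaled disagreements. -/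
theorem norm_disagreementPerturbation_le {d N : ℕ} {φ : AgentState d → ℝ} {c : NNReal}
    (hφ : LipschitzWith c φ) {g : ℝ} (hg : 1 ≤ g) (o : Fin N) (w : Fin N → AgentState d) :
    ‖disagreementPerturbation φ o g w‖ ≤ c * d * ‖scaledDisagreement o g w‖ := by
  have hg0 : 0 < g := by linarith
  refine (pi_norm_le_iff_of_nonneg (by positivity)).2 fun k =>
    (pi_norm_le_iff_of_nonneg (by positivity)).2 fun i => ?_
  by_cases hi : (i : ℕ) + 1 = d
  · have h1 := hφ.dist_le_mul (w k) (w o)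
    rw [dist_eq_norm, dist_eq_norm] at h1
    have h2 := norm_sub_le_scaledDisagreement hg o k w
    have h3 : disagreementPerturbation φ o g w k i = (φ (w k) - φ (w o)) / g ^ d := by
      simp only [disagreementPerturbation, hi, if_true]
    rw [h3, norm_div, Real.norm_of_nonneg (by positivity : 0 ≤ g ^ d),
      div_le_iff₀ (by positivity)]
    calc ‖φ (w k) - φ (w o)‖ ≤ c * ‖w k - w o‖ := h1
      _ ≤ c * (d * (g ^ d * ‖scaledDisagreement o g w‖)) := by gcongr
      _ = _ := by ring
  · simp only [disagreementPerturbation, hi, if_false, zero_div, norm_zero]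
    positivity

/-- `w` solves the closed loop with the topology `G` on the interval `[t₀, t₁]`. -/
def SolvesOn {d N : ℕ} (φ : AgentState d → ℝ) (G : CommTopology N)
    (K : Matrix (Fin d) (Fin 1) ℝ) (w : ℝ → Fin N → AgentState d) (t₀ t₁ : ℝ) : Prop :=
  ∀ t ∈ Set.Icc t₀ t₁, HasDerivWithinAt w (networkField φ G K (w t)) (Set.Icc t₀ t₁) t

theorem SolvesOn.scaledDisagreement {d N : ℕ} (hd : 0 < d) {φ : AgentState d → ℝ}
    {G : CommTopology N} {P : Matrix (Fin d) (Fin d) ℝ} (hP : Pᵀ = P) (μ : ℝ) {g : ℝ} (hg : 1 ≤ g)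
    {w : ℝ → Fin N → AgentState d} {t₀ t₁ : ℝ} (hw : SolvesOn φ G (gain P g) w t₀ t₁)
    (o : Fin N) {t : ℝ} (ht : t ∈ Set.Icc t₀ t₁) :
    HasDerivWithinAt (fun t => Consensus.scaledDisagreement o g (w t))
      (g • disagreementField P (G.reducedLaplacian o μ) (Consensus.scaledDisagreement o g (w t)) +
        disagreementPerturbation φ o g (w t)) (Set.Icc t₀ t₁) t := by
  rw [← scaledDisagreement_networkField hd φ G hP μ (by linarith)]
  exact (Consensus.scaledDisagreement o g).hasFDerivAt.comp_hasDerivWithinAt t (hw t ht)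

theorem exists_disagreement_decay {d N : ℕ} (hd : 0 < d) {φ : AgentState d → ℝ} {c : NNReal}
    (hφ : LipschitzWith c φ) {G : CommTopology N} (hG : G.Connected) {μ a : ℝ}
    (hμ : G.SpectralBound μ) (ha : 0 < a) {P : Matrix (Fin d) (Fin d) ℝ}
    (hP : IsRiccatiSolution P μ a) (o : Fin N) :
    ∃ M κ g₀ : ℝ, 1 ≤ M ∧ 0 < κ ∧ 1 ≤ g₀ ∧ ∀ g, g₀ ≤ g → ∀ w t₀ t₁,
      SolvesOn φ G (gain P g) w t₀ t₁ → ∀ t ∈ Set.Icc t₀ t₁,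
        ‖scaledDisagreement o g (w t)‖ ≤
          M * Real.exp (-(g * κ) * (t - t₀)) * ‖scaledDisagreement o g (w t₀)‖ := by
  have hPt : Pᵀ = P := by simpa using hP.posDef.isHermitian.eq
  obtain ⟨b, hb1, hb2, hb3⟩ := exists_lyapunov_form ha hP
    (fun z => hG.le_re_of_mem_spectrum hμ o (z := z))
  obtain ⟨M, κ, hM, hκ, h⟩ := exists_exponential_decay (E := Fin N → Fin d → ℝ) b
    (disagreementField P (G.reducedLaplacian o μ)) hb1 hb2 hb3
  obtain ⟨g₀, hg₀⟩ := h (c * d) (by positivity)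
  refine ⟨M, κ, max 1 g₀, hM, hκ, le_max_left _ _, fun g hg w t₀ t₁ hw => ?_⟩
  have hg1 : 1 ≤ g := (le_max_left _ _).trans hg
  exact hg₀ g ((le_max_right _ _).trans hg) (fun t => scaledDisagreement o g (w t))
    (fun t => disagreementPerturbation φ o g (w t)) t₀ t₁
    (fun t ht => hw.scaledDisagreement hd hPt μ hg1 o ht)
    (fun t _ => norm_disagreementPerturbation_le hφ hg1 o (w t))

theorem exists_disagreement_growth {d N : ℕ} (hd : 0 < d) {φ : AgentState d → ℝ} {c : NNReal}
    (hφ : LipschitzWith c φ) (G : CommTopology N) {P : Matrix (Fin d) (Fin d) ℝ} (hP : Pᵀ = P)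
    (o : Fin N) :
    ∃ r : ℝ, 0 ≤ r ∧ ∀ g, 1 ≤ g → ∀ w t₀ t₁,
      SolvesOn φ G (gain P g) w t₀ t₁ → ∀ t ∈ Set.Icc t₀ t₁,
        ‖scaledDisagreement o g (w t)‖ ≤
          Real.exp (g * r * (t - t₀)) * ‖scaledDisagreement o g (w t₀)‖ := by
  let A := LinearMap.toContinuousLinearMap (disagreementField P (G.reducedLaplacian o 0))
  refine ⟨‖A‖ + c * d, by positivity, fun g hg w t₀ t₁ hw t ht => ?_⟩
  refine norm_le_exp_mul_of_deriv
    (fun s hs => hw.scaledDisagreement hd hP 0 hg o hs) (fun s _ => ?_) ht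
  refine (norm_add_le _ _).trans ?_
  have h1 := norm_disagreementPerturbation_le hφ hg o (w s)
  have h2 : ‖g • A (scaledDisagreement o g (w s))‖ ≤ g * (‖A‖ * ‖scaledDisagreement o g (w s)‖) := by
    rw [norm_smul, Real.norm_of_nonneg (by linarith)]
    gcongr
    exact A.le_opNorm _
  have h3 : 0 ≤ (c * d : ℝ) * ‖scaledDisagreement o g (w s)‖ := by positivity
  refine (add_le_add h2 h1).trans ?_
  nlinarith

/-- Disagreements decay on connected intervals and have bounded growth on all intervals, with rates
proportional to `g` and constants common to finitely many topologies. -/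
theorem exists_uniform_disagreement_bounds {d N Nt : ℕ} (hd : 0 < d) {φ : AgentState d → ℝ}
    {c : NNReal} (hφ : LipschitzWith c φ) {G : Fin Nt → CommTopology N} {μ a : ℝ}
    (hμ : ∀ i, (G i).SpectralBound μ) (ha : 0 < a) {P : Matrix (Fin d) (Fin d) ℝ}
    (hP : IsRiccatiSolution P μ a) (o : Fin N) :
    ∃ M κ r g₀ : ℝ, 1 ≤ M ∧ 0 < κ ∧ 0 ≤ r ∧ 1 ≤ g₀ ∧ ∀ g, g₀ ≤ g → ∀ i w t₀ t₁,
      SolvesOn φ (G i) (gain P g) w t₀ t₁ → ∀ t ∈ Set.Icc t₀ t₁,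
        ((G i).Connected → ‖scaledDisagreement o g (w t)‖ ≤
          M * Real.exp (-(g * κ) * (t - t₀)) * ‖scaledDisagreement o g (w t₀)‖) ∧
        ‖scaledDisagreement o g (w t)‖ ≤
          Real.exp (g * r * (t - t₀)) * ‖scaledDisagreement o g (w t₀)‖ := by
  have hPt : Pᵀ = P := by simpa using hP.posDef.isHermitian.eq
  have h1 : ∀ i, ∃ M κ g₀ : ℝ, 1 ≤ M ∧ 0 < κ ∧ 1 ≤ g₀ ∧ ∀ g, g₀ ≤ g → ∀ w t₀ t₁,
      SolvesOn φ (G i) (gain P g) w t₀ t₁ → ∀ t ∈ Set.Icc t₀ t₁, (G i).Connected →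
        ‖scaledDisagreement o g (w t)‖ ≤
          M * Real.exp (-(g * κ) * (t - t₀)) * ‖scaledDisagreement o g (w t₀)‖ := by
    intro i
    by_cases hi : (G i).Connected
    · obtain ⟨M, κ, g₀, hM, hκ, hg₀, h⟩ := exists_disagreement_decay hd hφ hi (hμ i) ha hP o
      exact ⟨M, κ, g₀, hM, hκ, hg₀, fun g hg w t₀ t₁ hw t ht _ => h g hg w t₀ t₁ hw t ht⟩
    -- Arbitrary constants: the decay claim is vacuous for a disconnected topology.
    · exact ⟨1, 1, 1, le_rfl, one_pos, le_rfl, fun _ _ _ _ _ _ _ _ h => absurd h hi⟩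
  choose M κ g₀ hM hκ hg₀ hdec using h1
  choose r hr hgrow using fun i => exists_disagreement_growth hd hφ (G i) hPt o
  obtain ⟨M', hM'⟩ := Finite.exists_le M
  obtain ⟨κ', hκ'⟩ := Finite.exists_le (fun i => (κ i)⁻¹)
  obtain ⟨g', hg'⟩ := Finite.exists_le g₀
  obtain ⟨r', hr'⟩ := Finite.exists_le r
  have hpos : 0 < max 1 κ' := by positivity
  refine ⟨max 1 M', (max 1 κ')⁻¹, max 0 r', max 1 g', le_max_left _ _, by positivity,
    le_max_left _ _, le_max_left _ _, fun g hg i w t₀ t₁ hw t ht => ⟨fun hi => ?_, ?_⟩⟩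
  · refine (hdec i g ((hg' i).trans ((le_max_right _ _).trans hg)) w t₀ t₁ hw t ht hi).trans ?_
    have hg0 : 0 ≤ g := zero_le_one.trans ((le_max_left _ _).trans hg)
    have ht0 : 0 ≤ t - t₀ := sub_nonneg.2 ht.1
    have h2 : (max 1 κ')⁻¹ ≤ κ i :=
      inv_le_of_inv_le₀ (hκ i) ((hκ' i).trans (le_max_right _ _))
    have h3 : g * (max 1 κ')⁻¹ * (t - t₀) ≤ g * κ i * (t - t₀) := by gcongr
    have h4 : M i ≤ max 1 M' := (hM' i).trans (le_max_right _ _)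
    gcongr
  · have hg1 : 1 ≤ g := (le_max_left _ _).trans hg
    have ht0 : 0 ≤ t - t₀ := sub_nonneg.2 ht.1
    refine (hgrow i g hg1 w t₀ t₁ hw t ht).trans ?_
    have h4 : r i ≤ max 0 r' := (hr' i).trans (le_max_right _ _)
    gcongr

/-! ### Switching sequences -/

namespace SwitchingSequence

variable {Nt : ℕ} (σ : SwitchingSequence Nt)

theorem time_zero : σ.time 0 = 0 := by simp [time]

theorem time_succ (i : ℕ) : σ.time (i + 1) = σ.time i + σ.len i := by
  simp [time, Finset.sum_range_succ]

theorem time_mono : Monotone σ.time :=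
  monotone_nat_of_le_succ fun i => by
    rw [time_succ]
    linarith [σ.len_nonneg i]

theorem time_nonneg (i : ℕ) : 0 ≤ σ.time i := by
  rw [← σ.time_zero]
  exact σ.time_mono (Nat.zero_le i)

/-- The total length of the first `p` intervals of even index. -/
def evenTime (p : ℕ) : ℝ := ∑ m ∈ Finset.range p, σ.len (2 * m)

theorem evenTime_succ (p : ℕ) : σ.evenTime (p + 1) = σ.evenTime p + σ.len (2 * p) := by
  simp [evenTime, Finset.sum_range_succ]

theorem evenTime_nonneg (p : ℕ) : 0 ≤ σ.evenTime p :=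
  Finset.sum_nonneg fun _ _ => σ.len_nonneg _

theorem time_two_mul_succ (p : ℕ) :
    σ.time (2 * (p + 1)) = σ.time (2 * p) + σ.len (2 * p) + σ.len (2 * p + 1) := by
  rw [show 2 * (p + 1) = 2 * p + 1 + 1 by ring, time_succ, time_succ]

theorem evenTime_le_time (p : ℕ) : σ.evenTime p ≤ σ.time (2 * p) := by
  induction p with
  | zero => simp [evenTime, time_zero]
  | succ p ih =>
    rw [evenTime_succ, time_two_mul_succ]
    linarith [σ.len_nonneg (2 * p + 1)]

theorem time_le_evenTime_add {T₀ : ℝ} (hT : ∀ p, σ.len (2 * p + 1) ≤ T₀) (p : ℕ) :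
    σ.time (2 * p) ≤ σ.evenTime p + p * T₀ := by
  induction p with
  | zero => simp [evenTime, time_zero]
  | succ p ih =>
    rw [evenTime_succ, time_two_mul_succ]
    push_cast
    linarith [hT p]

variable {σ}

theorem exists_mem_Ico (hσ : Filter.Tendsto σ.time Filter.atTop Filter.atTop) {t : ℝ}
    (ht : 0 ≤ t) : ∃ i, t ∈ Set.Ico (σ.time i) (σ.time (i + 1)) := by
  classical
  have hex : ∃ i, t < σ.time i := (hσ.eventually_gt_atTop t).exists
  have h0 : Nat.find hex ≠ 0 := fun h => by
    have := Nat.find_spec hex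
    rw [h, time_zero] at this
    linarith
  obtain ⟨i, hi⟩ := Nat.exists_eq_succ_of_ne_zero h0
  refine ⟨i, not_lt.1 (Nat.find_min hex (by omega)), ?_⟩
  have := Nat.find_spec hex
  rwa [hi] at this

namespace Admissible

variable {N n₀ : ℕ} {G : Fin Nt → CommTopology N} {T₀ τ : ℝ}

theorem len_odd_le (h : σ.Admissible G T₀ τ n₀) (hT₀ : 0 ≤ T₀) (p : ℕ) :
    σ.len (2 * p + 1) ≤ T₀ := by
  rcases (σ.len_nonneg (2 * p + 1)).eq_or_lt with h0 | h0
  · rw [← h0]; exact hT₀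
  · refine h.disconnected_le _ fun hc => ?_
    exact absurd ((h.alternate _ h0).1 hc) (by simp)

/-- The dwell condition with index `n` sums `n + 1` intervals, which is why `p` intervals yield `p -
1 - n₀`. -/
theorem dwell_evenTime (h : σ.Admissible G T₀ τ n₀) (hτ : 0 ≤ τ) (p : ℕ) :
    τ * ((p : ℝ) - 1 - n₀) ≤ σ.evenTime p := by
  cases p with
  | zero =>
    have h1 : 0 ≤ τ * (1 + n₀) := by positivity
    simp only [evenTime, Finset.range_zero, Finset.sum_empty, Nat.cast_zero]
    linarith
  | succ n =>
    have h1 := h.dwell 0 n (by simp)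
    simp only [zero_add] at h1
    push_cast
    rw [add_sub_cancel_right]
    exact h1

/-- Switching times cannot accumulate, so the intervals cover `[0, ∞)`. -/
theorem tendsto_time (h : σ.Admissible G T₀ τ n₀) (hτ : 0 < τ) :
    Filter.Tendsto σ.time Filter.atTop Filter.atTop := by
  refine Filter.tendsto_atTop_atTop_of_monotone σ.time_mono fun b => ?_
  obtain ⟨p, hp⟩ := exists_nat_ge (b / τ + 1 + n₀)
  refine ⟨2 * p, le_trans ?_ ((h.dwell_evenTime hτ.le p).trans (σ.evenTime_le_time p))⟩
  have h1 : b / τ ≤ (p : ℝ) - 1 - n₀ := by linarith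
  rw [div_le_iff₀ hτ] at h1
  linarith

/-- Decay at rate `k` on even intervals and growth at rate at most `r` on odd intervals give
overall exponential decay if the average dwell time is long enough. -/
theorem exponential_decay (h : σ.Admissible G T₀ τ n₀) (hT₀ : 0 ≤ T₀) (hτ : 0 < τ)
    {ρ : ℝ → ℝ} {η k r : ℝ} (hr : 0 ≤ r) (hη : 0 ≤ η) (hρ : 0 ≤ ρ 0)
    (heven : ∀ p, ∀ t ∈ Set.Icc (σ.time (2 * p)) (σ.time (2 * p + 1)),
      ρ t ≤ Real.exp (η - k * (t - σ.time (2 * p))) * ρ (σ.time (2 * p)))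
    (hodd : ∀ p, ∀ t ∈ Set.Icc (σ.time (2 * p + 1)) (σ.time (2 * p + 2)),
      ρ t ≤ Real.exp (r * (t - σ.time (2 * p + 1))) * ρ (σ.time (2 * p + 1)))
    (hk : (η + r * T₀) / τ ≤ k / 2) {t : ℝ} (ht : 0 ≤ t) :
    ρ t ≤ Real.exp ((η + r * T₀) * (n₀ + 2) +
      k / (2 * (1 + T₀ / τ)) * ((n₀ + 2) * T₀)) *
        Real.exp (-(k / (2 * (1 + T₀ / τ))) * t) * ρ 0 := by
  -- The logarithm of the worst loss in a cycle: overshoot on the even interval plus growth on the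
  -- odd one.
  set θ := η + r * T₀ with hθ
  have hθ0 : 0 ≤ θ := by positivity
  have hk0 : 0 ≤ k := by
    have : 0 ≤ θ / τ := by positivity
    linarith
  have hlen := h.len_odd_le hT₀
  have hmid : ∀ p, ρ (σ.time (2 * p)) ≤ Real.exp (p * θ - k * σ.evenTime p) * ρ 0 →
      ∀ t ∈ Set.Icc (σ.time (2 * p)) (σ.time (2 * p + 1)),
      ρ t ≤ Real.exp (p * θ + η - k * (σ.evenTime p + (t - σ.time (2 * p)))) * ρ 0 := by
    intro p hp t ht
    calc ρ t ≤ _ := heven p t ht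
      _ ≤ Real.exp (η - k * (t - σ.time (2 * p))) *
          (Real.exp (p * θ - k * σ.evenTime p) * ρ 0) := by gcongr
      _ = _ := by rw [← mul_assoc, ← Real.exp_add]; ring_nf
  have hend : ∀ p, ρ (σ.time (2 * p)) ≤ Real.exp (p * θ - k * σ.evenTime p) * ρ 0 →
      ∀ t ∈ Set.Icc (σ.time (2 * p + 1)) (σ.time (2 * p + 2)),
      ρ t ≤ Real.exp ((p + 1 : ℕ) * θ - k * σ.evenTime (p + 1)) * ρ 0 := by
    intro p hp t ht
    have h1 := hmid p hp (σ.time (2 * p + 1)) ⟨σ.time_mono (by omega), le_rfl⟩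
    have h2 : t - σ.time (2 * p + 1) ≤ T₀ := by
      have h3 := ht.2
      rw [σ.time_succ (2 * p + 1)] at h3
      linarith [hlen p]
    calc ρ t ≤ _ := hodd p t ht
      _ ≤ Real.exp (r * (t - σ.time (2 * p + 1))) *
          (Real.exp (p * θ + η - k * (σ.evenTime p +
            (σ.time (2 * p + 1) - σ.time (2 * p)))) * ρ 0) := by gcongr
      _ ≤ Real.exp (r * T₀) * (Real.exp (p * θ + η - k * (σ.evenTime p +
            (σ.time (2 * p + 1) - σ.time (2 * p)))) * ρ 0) := by gcongr
      _ = _ := by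
        rw [← mul_assoc, ← Real.exp_add, evenTime_succ, σ.time_succ (2 * p), hθ]
        push_cast
        ring_nf
  have hstart : ∀ p, ρ (σ.time (2 * p)) ≤ Real.exp (p * θ - k * σ.evenTime p) * ρ 0 := by
    intro p
    induction p with
    | zero => simp [evenTime, time_zero]
    | succ p ih =>
      exact hend p ih _ ⟨σ.time_mono (by omega), σ.time_mono (by omega)⟩
  -- Here `q` counts the cycles begun before or at `t`, the current one included, and `s` is the
  -- time spent up to `t` in even intervals.
  have hmain : ∃ (q : ℕ) (s : ℝ), 0 ≤ s ∧ τ * ((q : ℝ) - 2 - n₀) ≤ s ∧ t ≤ s + q * T₀ ∧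
      ρ t ≤ Real.exp (q * θ - k * s) * ρ 0 := by
    obtain ⟨i, hi⟩ := exists_mem_Ico (h.tendsto_time hτ) ht
    obtain ⟨p, rfl | rfl⟩ := Nat.even_or_odd' i
    · refine ⟨p + 1, σ.evenTime p + (t - σ.time (2 * p)), ?_, ?_, ?_, ?_⟩
      · linarith [σ.evenTime_nonneg p, hi.1]
      · have h1 := h.dwell_evenTime hτ.le p
        have h2 : ((p + 1 : ℕ) : ℝ) - 2 - n₀ = p - 1 - n₀ := by push_cast; ring
        rw [h2]
        linarith [hi.1]
      · have h1 := σ.time_le_evenTime_add hlen p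
        push_cast
        linarith
      · refine (hmid p (hstart p) t ⟨hi.1, hi.2.le⟩).trans ?_
        gcongr
        have : 0 ≤ r * T₀ := by positivity
        push_cast
        linarith
    · refine ⟨p + 1, σ.evenTime (p + 1), σ.evenTime_nonneg _, ?_, ?_,
        hend p (hstart p) t ⟨hi.1, hi.2.le⟩⟩
      · refine le_trans ?_ (h.dwell_evenTime hτ.le (p + 1))
        gcongr
        norm_num
      · exact hi.2.le.trans (σ.time_le_evenTime_add hlen (p + 1))
  obtain ⟨q, s, hs, hq, hts, hρt⟩ := hmain
  refine hρt.trans ?_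
  rw [← Real.exp_add]
  gcongr
  -- Since `q ≤ s / τ + n₀ + 2` and `θ / τ ≤ k / 2`, the losses use up at most half of the decay `k
  -- * s`, apart from a constant. The other half equals `lam * s * (1 + T₀ / τ)`, and `s * (1 + T₀ /
  -- τ)` is at least `t` minus a constant.
  set lam := k / (2 * (1 + T₀ / τ)) with hlam
  have hden : 0 < 1 + T₀ / τ := by positivity
  have hlam0 : 0 ≤ lam := by positivity
  have hq' : (q : ℝ) ≤ s / τ + n₀ + 2 := by
    have h1 : (q : ℝ) - 2 - n₀ ≤ s / τ := by
      rw [le_div_iff₀ hτ]; linarith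
    linarith
  have h1 : q * θ ≤ (s / τ + n₀ + 2) * θ := by gcongr
  have h2 : s * (θ / τ) ≤ s * (k / 2) := by gcongr
  have h3 : s / τ * θ = s * (θ / τ) := by ring
  have h4 : t ≤ s * (1 + T₀ / τ) + (n₀ + 2) * T₀ := by
    have h5 : q * T₀ ≤ (s / τ + n₀ + 2) * T₀ := by gcongr
    have h6 : s / τ * T₀ = s * (T₀ / τ) := by ring
    linarith
  have h5 : lam * t ≤ lam * (s * (1 + T₀ / τ) + (n₀ + 2) * T₀) := by gcongr
  have h6 : lam * (s * (1 + T₀ / τ)) = s * (k / 2) := by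
    rw [hlam]; field_simp
  linarith

end Admissible

end SwitchingSequence

/-! ### An agent of the network as an agent with input -/

theorem lipschitzWith_drift {d : ℕ} {φ : AgentState d → ℝ} {c : NNReal} (hφ : LipschitzWith c φ) :
    ∃ K : NNReal, LipschitzWith K (drift φ) := by
  let A : AgentState d →L[ℝ] AgentState d := LinearMap.toContinuousLinearMap
    (Matrix.toEuclideanLin (S d))
  let b : AgentState d := WithLp.toLp 2 fun i : Fin d => if (i : ℕ) + 1 = d then (1 : ℝ) else 0
  have h : drift φ = fun w => A w + φ w • b := by
    ext w i
    rw [drift_apply]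
    simp [A, b, Matrix.mulVec, dotProduct, Matrix.toEuclideanLin]
  refine ⟨‖A‖₊ + c * ‖b‖₊, ?_⟩
  rw [h]
  refine A.lipschitz.add (LipschitzWith.of_dist_le_mul fun x y => ?_)
  rw [dist_eq_norm, ← sub_smul, norm_smul, ← dist_eq_norm]
  push_cast
  calc dist (φ x) (φ y) * ‖b‖ ≤ c * dist x y * ‖b‖ := by gcongr; exact hφ.dist_le_mul x y
    _ = _ := by ring

/-- A curve whose right derivative differs boundedly from the drift is an agent solution. -/
theorem exists_isInput_of_hasDerivWithinAt {d : ℕ} {φ : AgentState d → ℝ} (hφ : Continuous (drift φ))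
    {v : ℝ → AgentState d} (hv : ContinuousOn v (Set.Ici 0)) {D : ℝ} (hD : 0 ≤ D)
    (hder : ∀ t, 0 ≤ t → ∃ u, HasDerivWithinAt v (drift φ (v t) + u) (Set.Ici t) t ∧ ‖u‖ ≤ D) :
    ∃ u, IsInput u ∧ IsAgentSolution φ u v ∧ ∀ t, ‖u t‖ ≤ D := by
  let v' : ℝ → AgentState d := fun t => v (max t 0)
  have hv' : Continuous v' := hv.comp_continuous (by fun_prop) fun t => Set.mem_Ici.2 (le_max_right _ _)
  -- The input is the residual of the equation. The right derivative serves because a two-sided one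
  -- may fail to exist at switching times, and it is measurable; `v'` extends `v` continuously to
  -- negative times.
  let u : ℝ → AgentState d :=
    (Set.Ici (0 : ℝ)).indicator (fun t => derivWithin v (Set.Ici t) t - drift φ (v' t))
  have hu : ∀ t, 0 ≤ t → HasDerivWithinAt v (drift φ (v t) + u t) (Set.Ici t) t ∧ ‖u t‖ ≤ D := by
    intro t ht
    obtain ⟨y, hy, hyD⟩ := hder t ht
    have h1 : u t = y := by
      have : v' t = v t := by simp [v', ht]
      simp only [u, Set.indicator_of_mem (Set.mem_Ici.2 ht), this,
        hy.derivWithin (uniqueDiffOn_Ici t t Set.self_mem_Ici)]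
      abel
    rw [h1]
    exact ⟨hy, hyD⟩
  have hmeas : Measurable u :=
    ((measurable_derivWithin_Ici v).sub (hφ.comp hv').measurable).indicator measurableSet_Ici
  have hbound : ∀ t, ‖u t‖ ≤ D := by
    intro t
    by_cases ht : 0 ≤ t
    · exact (hu t ht).2
    · have : u t = 0 := Set.indicator_of_notMem (by simpa using ht) _
      rw [this, norm_zero]; exact hD
  refine ⟨u, ⟨hmeas, fun t => ⟨D, ?_⟩⟩, ⟨hv, fun t ht => ?_⟩, hbound⟩
  · rintro _ ⟨s, _, rfl⟩
    exact hbound s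
  · have hIcc : Set.Icc 0 t ⊆ Set.Ici 0 := fun s hs => hs.1
    have hint : IntervalIntegrable (fun s => drift φ (v s) + u s) MeasureTheory.volume 0 t := by
      refine IntervalIntegrable.add ?_ ?_
      · refine ContinuousOn.intervalIntegrable ?_
        rw [Set.uIcc_of_le ht]
        exact hφ.comp_continuousOn (hv.mono hIcc)
      · rw [intervalIntegrable_iff]
        exact MeasureTheory.Measure.integrableOn_of_bounded (M := D) (by simp)
          hmeas.aestronglyMeasurable (Filter.Eventually.of_forall hbound)
    have h1 := intervalIntegral.integral_eq_sub_of_hasDeriv_right_of_le ht (hv.mono hIcc)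
      (fun s hs => (hu s hs.1.le).1.mono Set.Ioi_subset_Ici_self) hint
    rw [h1]; abel

/-! ### Regularity of the motions of the network -/

section Regularity

variable {d N Nt : ℕ} {φ : AgentState d → ℝ} {G : Fin Nt → CommTopology N}
  {K : Matrix (Fin d) (Fin 1) ℝ} {σ : SwitchingSequence Nt} {w : ℝ → Fin N → AgentState d}

theorem IsNetworkSolution.continuousOn (hw : IsNetworkSolution φ G K σ w)
    (hσ : Filter.Tendsto σ.time Filter.atTop Filter.atTop) : ContinuousOn w (Set.Ici 0) := by
  have h1 : ∀ n, ContinuousOn w (Set.Icc 0 (σ.time n)) := by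
    intro n
    induction n with
    | zero => rw [σ.time_zero, Set.Icc_self]; exact continuousOn_singleton _ _
    | succ n ih =>
      rw [← Set.Icc_union_Icc_eq_Icc (σ.time_nonneg n) (σ.time_mono n.le_succ)]
      exact ih.union_of_isClosed (fun t ht => (hw n t ht).continuousWithinAt) isClosed_Icc
        isClosed_Icc
  intro t ht
  obtain ⟨n, hn⟩ := (hσ.eventually_gt_atTop t).exists
  refine (h1 n t ⟨ht, hn.le⟩).mono_of_mem_nhdsWithin ?_
  rw [mem_nhdsWithin_iff_exists_mem_nhds_inter]
  exact ⟨Set.Iic (σ.time n), Iic_mem_nhds hn, fun s hs => ⟨hs.2, hs.1⟩⟩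

theorem IsNetworkSolution.hasDerivWithinAt_Ici (hw : IsNetworkSolution φ G K σ w)
    (hσ : Filter.Tendsto σ.time Filter.atTop Filter.atTop) {t : ℝ} (ht : 0 ≤ t) :
    ∃ i, HasDerivWithinAt w (networkField φ (G (σ.top i)) K (w t)) (Set.Ici t) t := by
  obtain ⟨i, hi⟩ := SwitchingSequence.exists_mem_Ico hσ ht
  exact ⟨i, (hw i t ⟨hi.1, hi.2.le⟩).mono_of_mem_nhdsWithin (Icc_mem_nhdsGE_of_mem hi)⟩

/-- The coupling sees only output differences, so the input of agent `o` vanishes with the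
disagreements, uniformly over the topologies. -/
theorem exists_norm_control_le (hd : 0 < d) (G : Fin Nt → CommTopology N)
    (K : Matrix (Fin d) (Fin 1) ℝ) {g : ℝ} (hg : 1 ≤ g) (o : Fin N) :
    ∃ D : ℝ, 0 ≤ D ∧ ∀ i w, ‖control (G i) K w o‖ ≤ D * ‖scaledDisagreement o g w‖ := by
  obtain ⟨D, hD⟩ := Finite.exists_le
    fun i => (d : ℝ) * ((∑ l, |K l 0|) * ∑ j, (G i).adj o j * (d * g ^ d))
  refine ⟨max 0 D, le_max_left _ _, fun i w => ?_⟩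
  refine (norm_le_card_mul_of_forall (c := (∑ l, |K l 0|) *
    ∑ j, (G i).adj o j * (d * g ^ d * ‖scaledDisagreement o g w‖)) fun l => ?_).trans ?_
  · rw [control_apply hd, abs_mul]
    have hsum : ∀ j, |(G i).adj o j * (w j ⟨0, hd⟩ - w o ⟨0, hd⟩)| ≤
        (G i).adj o j * (d * g ^ d * ‖scaledDisagreement o g w‖) := by
      intro j
      rw [abs_mul, abs_of_nonneg ((G i).adj_nonneg o j), mul_assoc (d : ℝ)]
      refine mul_le_mul_of_nonneg_left ?_ ((G i).adj_nonneg o j)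
      exact (PiLp.norm_apply_le (w j - w o) ⟨0, hd⟩).trans
        (norm_sub_le_scaledDisagreement hg o j w)
    gcongr
    · exact Finset.single_le_sum (f := fun l => |K l 0|) (fun _ _ => abs_nonneg _)
        (Finset.mem_univ l)
    · exact (Finset.abs_sum_le_sum_abs _ _).trans (Finset.sum_le_sum fun j _ => hsum j)
  · simp only [← mul_assoc, ← Finset.sum_mul]
    refine mul_le_mul_of_nonneg_right ?_ (norm_nonneg _)
    refine le_trans (le_of_eq ?_) ((hD i).trans (le_max_right _ _))
    simp only [mul_assoc, ← Finset.sum_mul]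

end Regularity

/-! ### Comparison functions and cascades -/

namespace IsClassK

variable {γ γ' : ℝ → ℝ}

theorem monotoneOn (h : IsClassK γ) : MonotoneOn γ (Set.Ici 0) := h.strictMonoOn.monotoneOn

theorem mono (h : IsClassK γ) {r s : ℝ} (hr : 0 ≤ r) (hrs : r ≤ s) : γ r ≤ γ s :=
  h.monotoneOn hr (hr.trans hrs) hrs

theorem nonneg (h : IsClassK γ) {r : ℝ} (hr : 0 ≤ r) : 0 ≤ γ r :=
  h.map_zero.symm.le.trans (h.mono le_rfl hr)

theorem mapsTo (h : IsClassK γ) : Set.MapsTo γ (Set.Ici 0) (Set.Ici 0) := fun _ hr => h.nonneg hr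

theorem comp (h : IsClassK γ) (h' : IsClassK γ') : IsClassK fun r => γ (γ' r) where
  continuousOn := h.continuousOn.comp h'.continuousOn h'.mapsTo
  strictMonoOn := h.strictMonoOn.comp h'.strictMonoOn h'.mapsTo
  map_zero := by rw [h'.map_zero, h.map_zero]

theorem max (h : IsClassK γ) (h' : IsClassK γ') : IsClassK fun r => max (γ r) (γ' r) where
  continuousOn := h.continuousOn.sup h'.continuousOn
  strictMonoOn := fun _ hr _ hs hrs =>
    max_lt_max (h.strictMonoOn hr hs hrs) (h'.strictMonoOn hr hs hrs)
  map_zero := by rw [h.map_zero, h'.map_zero, max_self]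

theorem add (h : IsClassK γ) (h' : IsClassK γ') : IsClassK fun r => γ r + γ' r where
  continuousOn := h.continuousOn.add h'.continuousOn
  strictMonoOn := fun _ hr _ hs hrs =>
    add_lt_add (h.strictMonoOn hr hs hrs) (h'.strictMonoOn hr hs hrs)
  map_zero := by rw [h.map_zero, h'.map_zero, add_zero]

theorem const_mul {c : ℝ} (hc : 0 < c) : IsClassK fun r => c * r where
  continuousOn := by fun_prop
  strictMonoOn := fun _ _ _ _ hrs => mul_lt_mul_of_pos_left hrs hc
  map_zero := mul_zero c

end IsClassK

/-- The comparison function of a cascade of an exponentially stable system, with overshoot `D` and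
rate `lam`, with an input-to-state stable one. -/
def cascadeBound (β : ℝ → ℝ → ℝ) (γ : ℝ → ℝ) (D lam r t : ℝ) : ℝ :=
  max (β (max (β r 0) (γ (D * r))) (t / 2)) (γ (D * Real.exp (-lam * (t / 2)) * r)) +
    D * Real.exp (-lam * t) * r

theorem isClassKL_cascadeBound {β : ℝ → ℝ → ℝ} {γ : ℝ → ℝ} (hβ : IsClassKL β) (hγ : IsClassK γ)
    {D lam : ℝ} (hD : 0 < D) (hlam : 0 < lam) : IsClassKL (cascadeBound β γ D lam) := by
  have hin : IsClassK fun r => max (β r 0) (γ (D * r)) :=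
    (hβ.isClassK 0 le_rfl).max (hγ.comp (IsClassK.const_mul hD))
  have hexp : Filter.Tendsto (fun t => Real.exp (-lam * t)) Filter.atTop (nhds 0) :=
    Real.tendsto_exp_atBot.comp (Filter.tendsto_id.const_mul_atTop_of_neg (neg_lt_zero.2 hlam))
  have hhalf : Filter.Tendsto (fun t : ℝ => t / 2) Filter.atTop Filter.atTop :=
    Filter.tendsto_id.atTop_div_const two_pos
  refine ⟨fun t ht => ?_, fun r hr => ?_, fun r hr => ?_⟩
  · exact (((hβ.isClassK (t / 2) (by linarith)).comp hin).max
      (hγ.comp (IsClassK.const_mul (by positivity)))).add (IsClassK.const_mul (by positivity))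
  · intro s hs t ht hst
    have hs' : 0 ≤ s := hs
    have ht' : 0 ≤ t := ht
    refine add_le_add (max_le_max ?_ ?_) ?_
    · exact hβ.antitoneOn _ (hin.nonneg hr) (Set.mem_Ici.2 (by linarith))
        (Set.mem_Ici.2 (by linarith)) (by linarith)
    · refine hγ.mono (by positivity) ?_
      gcongr ?_ * Real.exp ?_ * _
      nlinarith
    · gcongr ?_ * Real.exp ?_ * _
      nlinarith
  · have h1 : Filter.Tendsto (fun t => β (max (β r 0) (γ (D * r))) (t / 2))
        Filter.atTop (nhds 0) := (hβ.tendsto_zero _ (hin.nonneg hr)).comp hhalf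
    have h2 : Filter.Tendsto (fun t => D * Real.exp (-lam * t) * r) Filter.atTop (nhds 0) := by
      simpa using (hexp.const_mul D).mul_const r
    have h3 : Filter.Tendsto (fun t => γ (D * Real.exp (-lam * (t / 2)) * r))
        Filter.atTop (nhds 0) := by
      have h4 : Filter.Tendsto γ (nhdsWithin 0 (Set.Ici 0)) (nhds 0) := by
        have := hγ.continuousOn 0 Set.self_mem_Ici
        rwa [ContinuousWithinAt, hγ.map_zero] at this
      refine h4.comp (tendsto_nhdsWithin_iff.2 ⟨h2.comp hhalf, Filter.Eventually.of_forall
        fun t => ?_⟩)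
      exact Set.mem_Ici.2 (by positivity : (0 : ℝ) ≤ D * Real.exp (-lam * (t / 2)) * r)
    have h5 := (h1.max h3).add h2
    rwa [max_self, add_zero] at h5

/-- The estimate is applied twice. From `0` to `t / 2` it bounds the driven state; from `t / 2` to
`t` the state is forgotten through `β`, while the input has already decayed to its level at time `t
/ 2`. -/
theorem isGloballyAsymptoticallyStable_of_cascade {X : Type*} [PseudoMetricSpace X]
    {traj : Set (ℝ → X)} {A : Set X} {β : ℝ → ℝ → ℝ} {γ : ℝ → ℝ} (hβ : IsClassKL β)
    (hγ : IsClassK γ) {D lam : ℝ} (hD : 0 < D) (hlam : 0 < lam) (y : X → ℝ) (hy0 : ∀ x, 0 ≤ y x)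
    (hy : ∀ x, y x ≤ Metric.infDist x A)
    (hdist : ∀ x ∈ traj, ∀ t, 0 ≤ t → Metric.infDist (x t) A ≤
      y (x t) + D * Real.exp (-lam * t) * Metric.infDist (x 0) A)
    (hiss : ∀ x ∈ traj, ∀ s t, 0 ≤ s → s ≤ t → y (x t) ≤
      max (β (y (x s)) (t - s)) (γ (D * Real.exp (-lam * s) * Metric.infDist (x 0) A))) :
    IsGloballyAsymptoticallyStable traj A := by
  refine ⟨cascadeBound β γ D lam, isClassKL_cascadeBound hβ hγ hD hlam, fun x hx t ht => ?_⟩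
  set r := Metric.infDist (x 0) A
  have hr : 0 ≤ r := Metric.infDist_nonneg
  have ht2 : 0 ≤ t / 2 := by linarith
  refine (hdist x hx t ht).trans ?_
  unfold cascadeBound
  gcongr
  have hmid : y (x (t / 2)) ≤ max (β r 0) (γ (D * r)) := by
    have h1 := hiss x hx 0 (t / 2) le_rfl ht2
    simp only [sub_zero, mul_zero, Real.exp_zero, mul_one] at h1
    refine h1.trans (max_le_max ?_ le_rfl)
    exact ((hβ.isClassK _ ht2).mono (hy0 _) (hy _)).trans
      (hβ.antitoneOn r hr Set.self_mem_Ici ht2 ht2)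
  have h2 := hiss x hx (t / 2) t ht2 (by linarith)
  rw [show t - t / 2 = t / 2 by ring] at h2
  exact h2.trans (max_le_max ((hβ.isClassK _ ht2).mono (hy0 _) hmid) le_rfl)

theorem IsGloballyAsymptoticallyStable.isInvariant {X : Type*} [PseudoMetricSpace X]
    {traj : Set (ℝ → X)} {A : Set X} (h : IsGloballyAsymptoticallyStable traj A)
    (hA : IsClosed A) : IsInvariant traj A := by
  obtain ⟨β, hβ, hx⟩ := h
  intro x hxt h0 t ht
  have h1 := hx x hxt t ht
  rw [Metric.infDist_zero_of_mem h0, (hβ.isClassK t ht).map_zero] at h1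
  rw [hA.mem_iff_infDist_zero ⟨x 0, h0⟩]
  exact le_antisymm h1 Metric.infDist_nonneg

/-! ### Distance to the synchronized set -/

section SyncSet

variable {d N : ℕ} {W : Set (AgentState d)}

theorem syncSet_eq_image (o : Fin N) :
    syncSet N W = (fun x : AgentState d => fun _ : Fin N => x) '' W := by
  ext w
  constructor
  · rintro ⟨h1, h2⟩
    exact ⟨w o, h1 o, funext fun k => h2 o k⟩
  · rintro ⟨x, hx, rfl⟩
    exact ⟨fun _ => hx, fun _ _ => rfl⟩

theorem isCompact_syncSet (o : Fin N) (hW : IsCompact W) : IsCompact (syncSet N W) := by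
  rw [syncSet_eq_image o]
  exact hW.image (by fun_prop)

theorem syncSet_nonempty (o : Fin N) (hW : W.Nonempty) : (syncSet N W).Nonempty := by
  rw [syncSet_eq_image o]
  exact hW.image _

theorem infDist_agent_le (o : Fin N) (hW : IsCompact W) (hW' : W.Nonempty)
    (w : Fin N → AgentState d) :
    Metric.infDist (w o) W ≤ Metric.infDist w (syncSet N W) := by
  obtain ⟨y, hy, hyd⟩ := (isCompact_syncSet o hW).exists_infDist_eq_dist
    (syncSet_nonempty o hW') w
  rw [hyd]
  exact (Metric.infDist_le_dist_of_mem (hy.1 o)).trans (dist_le_pi_dist w y o)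

theorem norm_scaledDisagreement_le (o : Fin N) (hW : IsCompact W) (hW' : W.Nonempty) (g : ℝ)
    (w : Fin N → AgentState d) : ‖scaledDisagreement o g w‖ ≤
      ‖scaledDisagreement (d := d) o g‖ * Metric.infDist w (syncSet N W) := by
  obtain ⟨y, hy, hyd⟩ := (isCompact_syncSet o hW).exists_infDist_eq_dist
    (syncSet_nonempty o hW') w
  have h1 : scaledDisagreement o g y = 0 := by
    have : y = fun _ => y o := funext fun k => hy.2 k o
    rw [this]
    exact scaledDisagreement_const o g _
  rw [hyd, dist_eq_norm]
  calc ‖scaledDisagreement o g w‖ = ‖scaledDisagreement o g (w - y)‖ := by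
        rw [map_sub, h1, sub_zero]
    _ ≤ _ := ContinuousLinearMap.le_opNorm _ _

theorem infDist_syncSet_le (o : Fin N) (hW : IsCompact W) (hW' : W.Nonempty) {g : ℝ} (hg : 1 ≤ g)
    (w : Fin N → AgentState d) : Metric.infDist w (syncSet N W) ≤
      Metric.infDist (w o) W + d * g ^ d * ‖scaledDisagreement o g w‖ := by
  obtain ⟨x, hx, hxd⟩ := hW.exists_infDist_eq_dist hW' (w o)
  have hmem : (fun _ => x) ∈ syncSet N W := ⟨fun _ => hx, fun _ _ => rfl⟩
  refine (Metric.infDist_le_dist_of_mem hmem).trans ?_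
  rw [hxd]
  have h0 : 0 ≤ g := by linarith
  refine (dist_pi_le_iff (by positivity)).2 fun k => ?_
  have h1 := norm_sub_le_scaledDisagreement hg o k w
  have h2 := dist_triangle (w k) (w o) x
  rw [dist_eq_norm (w k) (w o)] at h2
  rw [mul_assoc]
  linarith

end SyncSet

/-! ### Existence of motions -/

section Existence

variable {E : Type*} [NormedAddCommGroup E] [NormedSpace ℝ E]

theorem hasDerivWithinAt_comp_sub {α : ℝ → E} {α' : E} {s T t : ℝ}
    (h : HasDerivWithinAt α α' (Set.Icc 0 T) (t - s)) :
    HasDerivWithinAt (fun t => α (t - s)) α' (Set.Icc s (s + T)) t := by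
  have h1 := h.scomp t ((hasDerivWithinAt_id t (Set.Icc s (s + T))).sub_const s)
    (t' := Set.Icc 0 T) (fun r hr => Set.mem_Icc.2
      ⟨sub_nonneg.2 hr.1, sub_le_iff_le_add'.2 hr.2⟩)
  rwa [one_smul] at h1

theorem exists_solution_glue {f : E → E} {α β : ℝ → E} {T S : ℝ} (hT : 0 ≤ T) (hS : 0 ≤ S)
    (hα : ∀ t ∈ Set.Icc 0 T, HasDerivWithinAt α (f (α t)) (Set.Icc 0 T) t)
    (hβ : ∀ t ∈ Set.Icc 0 S, HasDerivWithinAt β (f (β t)) (Set.Icc 0 S) t)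
    (hαβ : β 0 = α T) :
    ∃ w : ℝ → E, w 0 = α 0 ∧
      ∀ t ∈ Set.Icc 0 (T + S), HasDerivWithinAt w (f (w t)) (Set.Icc 0 (T + S)) t := by
  let w : ℝ → E := fun t => if t ≤ T then α t else β (t - T)
  have hw1 : Set.EqOn w α (Set.Icc 0 T) := fun t ht => if_pos ht.2
  have hw2 : Set.EqOn w (fun t => β (t - T)) (Set.Icc T (T + S)) := by
    intro t ht
    rcases ht.1.eq_or_lt with h | h
    · subst h; simp [w, hαβ]
    · exact if_neg (not_le.2 h)
  have hd1 : ∀ t ∈ Set.Icc 0 T, HasDerivWithinAt w (f (w t)) (Set.Icc 0 T) t := fun t ht => by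
    rw [hw1 ht]
    exact (hα t ht).congr hw1 (hw1 ht)
  have hd2 : ∀ t ∈ Set.Icc T (T + S), HasDerivWithinAt w (f (w t)) (Set.Icc T (T + S)) t :=
    fun t ht => by
      rw [hw2 ht]
      exact (hasDerivWithinAt_comp_sub (hβ (t - T) ⟨by linarith [ht.1], by linarith [ht.2]⟩)).congr
        hw2 (hw2 ht)
  refine ⟨w, if_pos hT, fun t ht => ?_⟩
  rcases lt_trichotomy t T with h | h | h
  · exact (hd1 t ⟨ht.1, h.le⟩).mono_of_mem_nhdsWithin (mem_nhdsWithin_iff_exists_mem_nhds_inter.2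
      ⟨Set.Iic T, Iic_mem_nhds h, fun s hs => ⟨hs.2.1, hs.1⟩⟩)
  · subst h
    have h1 := (hd1 t ⟨hT, le_rfl⟩).union (hd2 t ⟨le_rfl, by linarith⟩)
    rwa [Set.Icc_union_Icc_eq_Icc hT (by linarith)] at h1
  · exact (hd2 t ⟨h.le, ht.2⟩).mono_of_mem_nhdsWithin (mem_nhdsWithin_iff_exists_mem_nhds_inter.2
      ⟨Set.Ici T, Ici_mem_nhds h, fun s hs => ⟨hs.1, hs.2.2⟩⟩)

/-- With a global Lipschitz constant the length `h` of local existence does not depend on the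
initial point, so finitely many steps reach `T`. -/
theorem exists_solution_of_lipschitzWith [CompleteSpace E] {f : E → E} {K : NNReal}
    (hf : LipschitzWith K f) (T : ℝ) (x : E) :
    ∃ w : ℝ → E, w 0 = x ∧ ∀ t ∈ Set.Icc 0 T, HasDerivWithinAt w (f (w t)) (Set.Icc 0 T) t := by
  set h : ℝ := 1 / (K + 1) with hh
  have hh0 : 0 < h := by positivity
  have hlocal : ∀ x, ∃ w : ℝ → E, w 0 = x ∧
      ∀ t ∈ Set.Icc 0 h, HasDerivWithinAt w (f (w t)) (Set.Icc 0 h) t := by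
    intro x
    -- On the ball of radius `‖f x‖` the field is bounded by `(1 + K) * ‖f x‖`; multiplied by `h = 1
    -- / (K + 1)` this is exactly the radius.
    have hPL : IsPicardLindelof (fun _ => f) (tmin := 0) (tmax := h)
        ⟨0, Set.left_mem_Icc.2 hh0.le⟩ x ‖f x‖₊ 0 (‖f x‖₊ + K * ‖f x‖₊) K := by
      refine IsPicardLindelof.of_time_independent (fun y hy => ?_) hf.lipschitzOnWith ?_
      · have h1 := hf.dist_le_mul y x
        have h2 : ‖f y‖ ≤ ‖f x‖ + dist (f y) (f x) := by
          rw [dist_eq_norm]; exact norm_le_norm_add_norm_sub' _ _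
        have h3 : (K : ℝ) * dist y x ≤ K * ‖f x‖ := by
          gcongr
          simpa using hy
        push_cast
        linarith
      · simp only [sub_zero, sub_self, max_eq_left hh0.le]
        push_cast
        rw [hh, sub_zero]
        field_simp
        linarith
    exact hPL.exists_eq_forall_mem_Icc_hasDerivWithinAt₀
  have hmul : ∀ n : ℕ, ∃ w : ℝ → E, w 0 = x ∧
      ∀ t ∈ Set.Icc 0 (n * h), HasDerivWithinAt w (f (w t)) (Set.Icc 0 (n * h)) t := by
    intro n
    induction n with
    | zero =>
      refine ⟨fun _ => x, rfl, fun t ht => ?_⟩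
      rw [Nat.cast_zero, zero_mul, Set.Icc_self] at ht ⊢
      rw [Set.mem_singleton_iff.1 ht]
      exact hasDerivWithinAt_iff_hasFDerivWithinAt.2
        (.of_subsingleton Set.subsingleton_singleton)
    | succ n ih =>
      obtain ⟨α, hα0, hα⟩ := ih
      obtain ⟨β, hβ0, hβ⟩ := hlocal (α (n * h))
      obtain ⟨w, hw0, hw⟩ := exists_solution_glue (by positivity) hh0.le hα hβ hβ0
      refine ⟨w, hw0.trans hα0, ?_⟩
      rw [Nat.cast_succ, add_mul, one_mul]
      exact hw
  obtain ⟨n, hn⟩ := exists_nat_ge (T / h)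
  rw [div_le_iff₀ hh0] at hn
  obtain ⟨w, hw0, hw⟩ := hmul n
  have hsub : Set.Icc 0 T ⊆ Set.Icc 0 (n * h) := Set.Icc_subset_Icc_right hn
  exact ⟨w, hw0, fun t ht => (hw t (hsub ht)).mono hsub⟩

end Existence

/-- Curves on consecutive intervals that match at the switching times form a single curve. -/
theorem exists_glue_sequence {F : Type*} [Zero F] {t : ℕ → ℝ} (ht : Monotone t) {α : ℕ → ℝ → F}
    (hα : ∀ i, α (i + 1) (t (i + 1)) = α i (t (i + 1))) :
    ∃ w : ℝ → F, ∀ i, Set.EqOn w (α i) (Set.Icc (t i) (t (i + 1))) := by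
  classical
  -- A time shared by intervals `i < j` is an end point of all those between them, which may have
  -- zero length, so the matching conditions chain.
  have hcons : ∀ i j s, i ≤ j → s ∈ Set.Icc (t i) (t (i + 1)) → t j ≤ s → α j s = α i s := by
    intro i j s hij hs hj
    induction j, hij using Nat.le_induction with
    | base => rfl
    | succ j hij ih =>
      have h1 : s = t (j + 1) :=
        le_antisymm (hs.2.trans (ht (by omega))) hj
      rw [← ih ((ht j.le_succ).trans hj), h1, hα]
  refine ⟨fun s => if h : ∃ i, s ∈ Set.Icc (t i) (t (i + 1)) then α h.choose s else 0,
    fun i s hs => ?_⟩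
  have hex : ∃ i, s ∈ Set.Icc (t i) (t (i + 1)) := ⟨i, hs⟩
  simp only [dif_pos hex]
  have hsp := hex.choose_spec
  rcases le_total i hex.choose with h | h
  · exact hcons i _ s h hs hsp.1
  · exact (hcons _ i s h hsp hs.1).symm

theorem exists_lipschitzWith_networkField {d N : ℕ} (hd : 0 < d) {φ : AgentState d → ℝ}
    {c : NNReal} (hφ : LipschitzWith c φ) (G : CommTopology N) (K : Matrix (Fin d) (Fin 1) ℝ) :
    ∃ k : NNReal, LipschitzWith k (networkField φ G K) := by
  obtain ⟨k, hk⟩ := lipschitzWith_drift hφ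
  let A : (Fin N → AgentState d) →L[ℝ] (Fin N → AgentState d) := LinearMap.toContinuousLinearMap
    { toFun := fun w => control G K w
      map_add' := fun v w => by
        ext k i
        simp only [Pi.add_apply, PiLp.add_apply, control_apply hd, ← mul_add,
          ← Finset.sum_add_distrib]
        congr 1
        exact Finset.sum_congr rfl fun j _ => by ring
      map_smul' := fun r w => by
        ext k i
        simp only [Pi.smul_apply, PiLp.smul_apply, control_apply hd, smul_eq_mul,
          RingHom.id_apply, Finset.mul_sum]
        exact Finset.sum_congr rfl fun j _ => by ring }
  have h1 : LipschitzWith k (fun (w : Fin N → AgentState d) i => drift φ (w i)) :=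
    LipschitzWith.of_dist_le_mul fun v w => (dist_pi_le_iff (by positivity)).2 fun i =>
      (hk.dist_le_mul _ _).trans (by gcongr; exact dist_le_pi_dist v w i)
  exact ⟨_, h1.add A.lipschitz⟩

theorem exists_isNetworkSolution {d N Nt : ℕ} (hd : 0 < d) {φ : AgentState d → ℝ} {c : NNReal}
    (hφ : LipschitzWith c φ) (G : Fin Nt → CommTopology N) (K : Matrix (Fin d) (Fin 1) ℝ)
    (σ : SwitchingSequence Nt) (x : Fin N → AgentState d) :
    ∃ w : ℝ → Fin N → AgentState d, w 0 = x ∧ IsNetworkSolution φ G K σ w := by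
  have hex : ∀ (i : ℕ) (y : Fin N → AgentState d), ∃ w : ℝ → Fin N → AgentState d, w 0 = y ∧
      ∀ t ∈ Set.Icc 0 (σ.len i),
        HasDerivWithinAt w (networkField φ (G (σ.top i)) K (w t)) (Set.Icc 0 (σ.len i)) t := by
    intro i y
    obtain ⟨k, hk⟩ := exists_lipschitzWith_networkField hd hφ (G (σ.top i)) K
    exact exists_solution_of_lipschitzWith hk (σ.len i) y
  choose sol hsol0 hsol using hex
  let y : ℕ → Fin N → AgentState d := fun n => Nat.rec x (fun i z => sol i z (σ.len i)) n
  have hy : ∀ i, y (i + 1) = sol i (y i) (σ.len i) := fun i => rfl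
  obtain ⟨w, hw⟩ := exists_glue_sequence σ.time_mono
    (α := fun i t => sol i (y i) (t - σ.time i)) (fun i => by
      simp only [sub_self, hsol0, hy]
      rw [σ.time_succ, add_sub_cancel_left])
  refine ⟨w, ?_, fun i t ht => ?_⟩
  · have h0 := hw 0 (Set.left_mem_Icc.2 (σ.time_mono (Nat.zero_le 1)))
    simp only [σ.time_zero, sub_self, hsol0] at h0
    exact h0
  · rw [hw i ht]
    refine HasDerivWithinAt.congr ?_ (hw i) (hw i ht)
    rw [σ.time_succ] at ht ⊢
    exact hasDerivWithinAt_comp_sub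
      (hsol i (y i) (t - σ.time i) ⟨by linarith [ht.1], by linarith [ht.2]⟩)

/-! ### Convergence of the closed loop -/

section ClosedLoop

variable {d N Nt n₀ : ℕ} {φ : AgentState d → ℝ} {G : Fin Nt → CommTopology N} {T₀ τ : ℝ}
  {σ : SwitchingSequence Nt} {P : Matrix (Fin d) (Fin d) ℝ} {g : ℝ}
  {w : ℝ → Fin N → AgentState d} {o : Fin N}

theorem IsNetworkSolution.scaledDisagreement_le (hw : IsNetworkSolution φ G (gain P g) σ w)
    (hσ : σ.Admissible G T₀ τ n₀) (hT₀ : 0 ≤ T₀) (hτ : 0 < τ) {M k r : ℝ} (hM : 1 ≤ M)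
    (hr : 0 ≤ r)
    (hbound : ∀ i t₀ t₁, SolvesOn φ (G i) (gain P g) w t₀ t₁ → ∀ t ∈ Set.Icc t₀ t₁,
        ((G i).Connected → ‖scaledDisagreement o g (w t)‖ ≤
          M * Real.exp (-k * (t - t₀)) * ‖scaledDisagreement o g (w t₀)‖) ∧
        ‖scaledDisagreement o g (w t)‖ ≤
          Real.exp (r * (t - t₀)) * ‖scaledDisagreement o g (w t₀)‖)
    (hk : (Real.log M + r * T₀) / τ ≤ k / 2) {t : ℝ} (ht : 0 ≤ t) :
    ‖scaledDisagreement o g (w t)‖ ≤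
      Real.exp ((Real.log M + r * T₀) * (n₀ + 2) + k / (2 * (1 + T₀ / τ)) * ((n₀ + 2) * T₀)) *
        Real.exp (-(k / (2 * (1 + T₀ / τ))) * t) * ‖scaledDisagreement o g (w 0)‖ := by
  have hM0 : 0 < M := by linarith
  have hlog : 0 ≤ Real.log M := Real.log_nonneg hM
  refine hσ.exponential_decay hT₀ hτ (ρ := fun t => ‖scaledDisagreement o g (w t)‖) hr hlog
    (norm_nonneg _) (fun p t ht => ?_) (fun p t ht => ?_) hk ht
  -- An even interval of zero length may carry a disconnected topology; there the estimate only
  -- needs `1 ≤ M`.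
  · rcases (σ.len_nonneg (2 * p)).eq_or_lt with h0 | h0
    · have h1 : t = σ.time (2 * p) := by
        have h2 := ht.2
        rw [σ.time_succ, ← h0, add_zero] at h2
        exact le_antisymm h2 ht.1
      rw [h1, sub_self, mul_zero, sub_zero]
      exact le_mul_of_one_le_left (norm_nonneg _) (Real.one_le_exp hlog)
    · have hconn := (hσ.alternate _ h0).2 (even_two_mul p)
      refine ((hbound _ _ _ (hw (2 * p)) t ht).1 hconn).trans (le_of_eq ?_)
      rw [show Real.log M - k * (t - σ.time (2 * p)) = Real.log M + -k * (t - σ.time (2 * p)) by ring,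
        Real.exp_add, Real.exp_log hM0]
  · exact (hbound _ _ _ (hw (2 * p + 1)) t ht).2

/-- The input-to-state estimate of the agent `o`, started at a time `s`. -/
theorem IsNetworkSolution.infDist_agent_le (hw : IsNetworkSolution φ G (gain P g) σ w)
    (hσ : Filter.Tendsto σ.time Filter.atTop Filter.atTop) (hφ : Continuous (drift φ))
    {W : Set (AgentState d)} {β : ℝ → ℝ → ℝ} {γ : ℝ → ℝ} (hγ : IsClassK γ)
    (hiss : ∀ u v : ℝ → AgentState d, IsInput u → IsAgentSolution φ u v → ∀ t, 0 ≤ t →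
      Metric.infDist (v t) W ≤
        max (β (Metric.infDist (v 0) W) t) (γ (sSup ((fun s => ‖u s‖) '' Set.Ico 0 t))))
    {s t D : ℝ} (hs : 0 ≤ s) (hst : s ≤ t) (hD : 0 ≤ D)
    (hcontrol : ∀ i r, s ≤ r → ‖control (G i) (gain P g) (w r) o‖ ≤ D) :
    Metric.infDist (w t o) W ≤ max (β (Metric.infDist (w s o) W) (t - s)) (γ D) := by
  have hcont : ContinuousOn (fun r => w (s + r) o) (Set.Ici 0) := by
    have h1 : ContinuousOn (fun r => w (s + r)) (Set.Ici 0) :=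
      (hw.continuousOn hσ).comp (by fun_prop) fun r hr => Set.mem_Ici.2 (add_nonneg hs hr)
    exact (continuous_apply o).comp_continuousOn h1
  obtain ⟨u, hu, hsol, huD⟩ := exists_isInput_of_hasDerivWithinAt hφ hcont hD fun r hr => by
    obtain ⟨i, hi⟩ := hw.hasDerivWithinAt_Ici hσ (add_nonneg hs hr)
    refine ⟨control (G (σ.top i)) (gain P g) (w (s + r)) o, ?_,
      hcontrol _ _ (le_add_of_nonneg_right hr)⟩
    have h1 := hi.scomp r ((hasDerivWithinAt_id r (Set.Ici r)).const_add s)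
      (t' := Set.Ici (s + r)) fun q hq => Set.mem_Ici.2 (add_le_add_right hq s)
    rw [one_smul] at h1
    exact hasDerivWithinAt_pi.1 h1 o
  have h2 := hiss u _ hu hsol (t - s) (sub_nonneg.2 hst)
  simp only [add_sub_cancel, add_zero] at h2
  refine h2.trans (max_le_max le_rfl (hγ.mono ?_ ?_))
  -- For `s = t` the supremum is over the empty set and equals `0`.
  · exact Real.sSup_nonneg (by rintro _ ⟨q, _, rfl⟩; exact norm_nonneg _)
  · exact Real.sSup_le (by rintro _ ⟨q, _, rfl⟩; exact huD q) hD

/-- Uniform exponential decay of the disagreements implies asymptotic stability of the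
synchronized set. -/
theorem isGloballyAsymptoticallyStable_syncSet (hd : 0 < d) {c : NNReal} (hφ : LipschitzWith c φ)
    {W : Set (AgentState d)} (hW : IsRobustAttractor φ W) (hτ : 0 < τ) (hg : 1 ≤ g) (o : Fin N)
    {D lam : ℝ} (hD : 0 ≤ D) (hlam : 0 < lam)
    (hdecay : ∀ σ : SwitchingSequence Nt, σ.Admissible G T₀ τ n₀ →
      ∀ w, IsNetworkSolution φ G (gain P g) σ w → ∀ t, 0 ≤ t →
        ‖scaledDisagreement o g (w t)‖ ≤
          D * Real.exp (-lam * t) * ‖scaledDisagreement o g (w 0)‖) :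
    IsGloballyAsymptoticallyStable (networkMotions φ G (gain P g) T₀ τ n₀) (syncSet N W) := by
  obtain ⟨β, γ, hβ, hγ, hiss⟩ := hW.isISS
  obtain ⟨k, hk⟩ := lipschitzWith_drift hφ
  obtain ⟨E, hE, hcontrol⟩ := exists_norm_control_le hd G (gain P g) hg o
  set F : ℝ := ‖scaledDisagreement (d := d) o g‖
  have hg0 : 0 < g := by linarith
  have hX : ∀ x ∈ networkMotions φ G (gain P g) T₀ τ n₀, ∀ t, 0 ≤ t →
      ‖scaledDisagreement o g (x t)‖ ≤
        D * F * (Real.exp (-lam * t) * Metric.infDist (x 0) (syncSet N W)) := by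
    rintro x ⟨σ, hσ, hx⟩ t ht
    calc _ ≤ _ := hdecay σ hσ x hx t ht
      _ ≤ D * Real.exp (-lam * t) * (F * Metric.infDist (x 0) (syncSet N W)) := by
        gcongr
        exact norm_scaledDisagreement_le o hW.isCompact hW.nonempty g _
      _ = _ := by ring
  have hF : 0 ≤ F := norm_nonneg _
  refine isGloballyAsymptoticallyStable_of_cascade hβ hγ
    -- One constant for two purposes: `E` converts disagreements into the input of `o`, `d * g ^ d`
    -- into distance to the synchronized set. The `+ 1` makes it positive.
    (D := (E + d * g ^ d) * (D * F) + 1) (by positivity) hlam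
    (fun w => Metric.infDist (w o) W) (fun _ => Metric.infDist_nonneg)
    (infDist_agent_le o hW.isCompact hW.nonempty) (fun x hx t ht => ?_)
    (fun x hx s t hs hst => ?_)
  · refine (infDist_syncSet_le o hW.isCompact hW.nonempty hg (x t)).trans (add_le_add le_rfl ?_)
    rw [mul_assoc _ (Real.exp _)]
    set q := Real.exp (-lam * t) * Metric.infDist (x 0) (syncSet N W)
    have hq : 0 ≤ q := mul_nonneg (Real.exp_pos _).le Metric.infDist_nonneg
    calc d * g ^ d * ‖scaledDisagreement o g (x t)‖ ≤ d * g ^ d * (D * F * q) := by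
          gcongr; exact hX x hx t ht
      _ ≤ d * g ^ d * (D * F * q) + (E * (D * F) * q + q) :=
          le_add_of_nonneg_right (by positivity)
      _ = _ := by ring
  · obtain ⟨σ, hσ, hxσ⟩ := id hx
    refine hxσ.infDist_agent_le (hσ.tendsto_time hτ) hk.continuous hγ hiss hs hst
      (mul_nonneg (by positivity) Metric.infDist_nonneg) fun i r hr => ?_
    refine (hcontrol i (x r)).trans ?_
    have h1 : Real.exp (-lam * r) ≤ Real.exp (-lam * s) := by
      rw [Real.exp_le_exp]; nlinarith
    rw [mul_assoc _ (Real.exp _)]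
    set q := Real.exp (-lam * s) * Metric.infDist (x 0) (syncSet N W)
    have hq : 0 ≤ q := mul_nonneg (Real.exp_pos _).le Metric.infDist_nonneg
    calc E * ‖scaledDisagreement o g (x r)‖ ≤ E * (D * F * q) := by
          gcongr
          refine (hX x hx r (hs.trans hr)).trans ?_
          gcongr
          exact mul_le_mul_of_nonneg_right h1 Metric.infDist_nonneg
      _ ≤ E * (D * F * q) + (d * g ^ d * (D * F) * q + q) :=
          le_add_of_nonneg_right (by positivity)
      _ = _ := by ring

end ClosedLoop

end Consensus

end

theorem proposition2 (d N Nt : ℕ) (hd : 1 ≤ d) (hN : 1 ≤ N)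
    (φ : Consensus.AgentState d → ℝ) (hφ : ∃ c : NNReal, LipschitzWith c φ)
    (W : Set (Consensus.AgentState d)) (hW : Consensus.IsRobustAttractor φ W)
    (G : Fin Nt → Consensus.CommTopology N)
    (μ : ℝ) (hμ : 0 < μ) (hG : ∀ i, (G i).SpectralBound μ)
    (T₀ : ℝ) (hT₀ : 0 < T₀)
    (a : ℝ) (ha : 0 < a) (P : Matrix (Fin d) (Fin d) ℝ)
    (hP : Consensus.IsRiccatiSolution P μ a) :
    ∃ τstar gstar : ℝ, 0 < τstar ∧ 0 < gstar ∧
      ∀ τ g : ℝ, τstar ≤ τ → gstar ≤ g → ∀ n₀ : ℕ, 1 ≤ n₀ →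
        (∀ σ : Consensus.SwitchingSequence Nt, σ.Admissible G T₀ τ n₀ →
          ∀ x : Fin N → Consensus.AgentState d, ∃ w : ℝ → Fin N → Consensus.AgentState d,
            w 0 = x ∧ Consensus.IsNetworkSolution φ G (Consensus.gain P g) σ w) ∧
        IsCompact (Consensus.syncSet N W) ∧
        Consensus.IsInvariant
          (Consensus.networkMotions φ G (Consensus.gain P g) T₀ τ n₀) (Consensus.syncSet N W) ∧
        Consensus.IsGloballyAsymptoticallyStable
          (Consensus.networkMotions φ G (Consensus.gain P g) T₀ τ n₀)
          (Consensus.syncSet N W) := by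
  obtain ⟨c, hc⟩ := hφ
  let o : Fin N := ⟨0, hN⟩
  obtain ⟨M, κ, r, g₀, hM, hκ, hr, hg₀, hbound⟩ :=
    Consensus.exists_uniform_disagreement_bounds hd hc hG ha hP o
  have hlog : 0 ≤ Real.log M := Real.log_nonneg hM
  -- The requirement is `(log M + g r T₀) / τ ≤ g κ / 2`. As `g ≥ 1`, `log M` may be replaced by `g
  -- * log M`, and `g` drops out. The `+ 1` gives positivity.
  refine ⟨2 * (Real.log M + r * T₀) / κ + 1, g₀, by positivity, by linarith,
    fun τ g hτ hg n₀ _ => ?_⟩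
  have hτ0 : 0 < τ := lt_of_lt_of_le (by positivity) hτ
  have hg1 : 1 ≤ g := hg₀.trans hg
  have hg0 : 0 < g := by linarith
  have hrate : (Real.log M + g * r * T₀) / τ ≤ g * κ / 2 := by
    have h1 : 2 * (Real.log M + r * T₀) ≤ τ * κ :=
      (div_le_iff₀ hκ).1 (by linarith)
    rw [div_le_iff₀ hτ0]
    calc Real.log M + g * r * T₀ ≤ g * Real.log M + g * r * T₀ := by
          gcongr; exact le_mul_of_one_le_left hlog hg1
      _ = g * (2 * (Real.log M + r * T₀)) / 2 := by ring
      _ ≤ g * (τ * κ) / 2 := by gcongr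
      _ = _ := by ring
  have hstable := Consensus.isGloballyAsymptoticallyStable_syncSet (Nt := Nt) (n₀ := n₀) (G := G)
    (T₀ := T₀) (P := P) hd hc hW hτ0 hg1 o (Real.exp_pos _).le
    (lam := g * κ / (2 * (1 + T₀ / τ))) (by positivity)
    (fun σ hσ w hw t ht => hw.scaledDisagreement_le hσ hT₀.le hτ0 hM (by positivity)
      (fun i t₀ t₁ h => hbound g hg i w t₀ t₁ h) hrate ht)
  have hcompact := Consensus.isCompact_syncSet o hW.isCompact
  exact ⟨fun σ _ x => Consensus.exists_isNetworkSolution hd hc G _ σ x, hcompact,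
    hstable.isInvariant hcompact.isClosed, hstable⟩
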